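/- Let $A$ be a left coherent ring and $B$ a right coherent ring (a ring is left coherent if every finitely generated submodule of a finitely presented left module is finitely presented). Write $A\text{-mod}$ and $\text{mod-}B$ for the abelian categories of left $A$-modules and right $B$-modules, and $A\text{-mod}_{fp}$, $\text{mod}_{fp}\text{-}B$ for their full subcategories of finitely presented modules (these are abelian, with exact inclusions). A complex $D^\bullet$ of $A$-$B$-bimodules is called a weak dualizing complex for $A$ and $B$ if (i) as a complex of left $A$-modules, $D^\bullet$ is quasi-isomorphic to a finite complex of injective left $A$-modules, and as a complex of right $B$-modules it is quasi-isomorphic to a finite complex of injective right $B$-modules; (ii) for every $n$ the cohomology bimodule $H^n(D^\bullet)$ is finitely presented as a left $A$-module and as a right $B$-module; (iii) the homothety maps $A\to \operatorname{Hom}_{\mathsf D(\text{mod-}B)}(D^\bullet,D^\bullet[*])$ and $B^{op}\to \operatorname{Hom}_{\mathsf D(A\text{-mod})}(D^\bullet,D^\bullet[*])$ are isomorphisms of graded rings, where $A$ and $B^{op}$ are placed in degree $0$. The derived functors $\mathbb R\mathrm{Hom}_A(-,D^\bullet)\colon \mathsf D^-(A\text{-mod})^{op}\to\mathsf D(\text{mod-}B)$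 and $\mathbb R\mathrm{Hom}_{B^{op}}(-,D^\bullet)\colon \mathsf D^-(\text{mod-}B)^{op}\to\mathsf D(A\text{-mod})$ are defined by applying the $\mathrm{Hom}$ complex into $D^\bullet$ to bounded above complexes of projective modules. Theorem. Let $D^\bullet$ be a weak dualizing complex for a left coherent ring $A$ and a right coherent ring $B$. Then there is an anti-equivalence between the bounded derived categories $\mathsf D^b(A\text{-mod}_{fp})$ and $\mathsf D^b(\text{mod}_{fp}\text{-}B)$ provided by the mutually inverse functors $\mathbb R\mathrm{Hom}_A(-,D^\bullet)$ and $\mathbb R\mathrm{Hom}_{B^{op}}(-,D^\bullet)$. That is, there is an equivalence of categories $\mathsf D^b(A\text{-mod}_{fp})^{op}\simeq\mathsf D^b(\text{mod}_{fp}\text{-}B)$ such that the functor in the forward direction, composed with the natural functor $\mathsf D^b(\text{mod}_{fp}\text{-}B)\to\mathsf D(\text{mod-}B)$, is isomorphic to the restriction of $\mathbb R\mathrm{Hom}_A(-,D^\bullet)$ along $\mathsf D^b(A\text{-mod}_{fp})\to\mathsf D^-(A\text{-mod})$, and the quasi-inverse functor, composed with the natural functor $\mathsf D^b(A\text{-mod}_{fp})\to\mathsf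 D(A\text{-mod})$, is isomorphic to the restriction of $\mathbb R\mathrm{Hom}_{B^{op}}(-,D^\bullet)$ along $\mathsf D^b(\text{mod}_{fp}\text{-}B)\to\mathsf D^-(\text{mod-}B)$. -/

import Mathlib

open CategoryTheory Limits Opposite
open scoped TensorProduct
universe w v u

/-- A ring `A` is left coherent if every finitely generated submodule of a finitely presented
left `A`-module is finitely presented. -/
class IsLeftCoherent (A : Type u) [Ring A] : Prop where
  finitePresentation_of_fg (M : Type u) [AddCommGroup M] [Module A M]
    [Module.FinitePresentation A M] (N : Submodule A M) (hN : N.FG) :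
    Module.FinitePresentation A N

/-- A ring `B` is right coherent if its opposite ring is left coherent. -/
abbrev IsRightCoherent (B : Type u) [Ring B] : Prop := IsLeftCoherent Bᵐᵒᵖ

/-- The property of being a finitely presented module. -/
def fpModules (A : Type u) [Ring A] : ObjectProperty (ModuleCat.{u} A) :=
  fun M ↦ Module.FinitePresentation A M

/-- The category of finitely presented left `A`-modules. -/
abbrev FpModuleCat (A : Type u) [Ring A] := (fpModules A).FullSubcategory

section fp

variable (A : Type u) [Ring A]

instance : (fpModules A).IsClosedUnderIsomorphisms where
  of_iso e h := by
    have : Module.FinitePresentation A _ := h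
    exact Module.FinitePresentation.of_equiv e.toLinearEquiv

instance : (fpModules A).ContainsZero where
  exists_zero := ⟨ModuleCat.of A PUnit.{u + 1}, ModuleCat.isZero_of_subsingleton _,
    inferInstanceAs (Module.FinitePresentation A PUnit.{u + 1})⟩

instance : (fpModules A).IsClosedUnderCokernels where
  cokernels_le := by
    rintro _ ⟨f, k, hk, ⟨h₁, h₂⟩⟩
    have : Module.FinitePresentation A _ := h₁
    have : Module.FinitePresentation A _ := h₂
    refine (fpModules A).prop_of_iso
      ((ModuleCat.cokernelIsColimit f).coconePointUniqueUpToIso hk) ?_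
    exact Module.finitePresentation_of_surjective (LinearMap.range f.hom).mkQ
      (Submodule.mkQ_surjective _)
      ((Submodule.ker_mkQ (LinearMap.range f.hom)).symm ▸ Module.Finite.iff_fg.1 inferInstance)

instance [IsLeftCoherent A] : (fpModules A).IsClosedUnderKernels where
  kernels_le := by
    rintro _ ⟨f, k, hk, ⟨h₁, h₂⟩⟩
    have : Module.FinitePresentation A _ := h₁
    have : Module.FinitePresentation A _ := h₂
    refine (fpModules A).prop_of_iso
      ((ModuleCat.kernelIsLimit f).conePointUniqueUpToIso hk) ?_
    have : Module.FinitePresentation A (LinearMap.range f.hom) :=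
      IsLeftCoherent.finitePresentation_of_fg _ _ (Module.Finite.iff_fg.1 inferInstance)
    have h := Module.FinitePresentation.fg_ker f.hom.rangeRestrict
      f.hom.surjective_rangeRestrict
    rw [LinearMap.ker_rangeRestrict] at h
    exact IsLeftCoherent.finitePresentation_of_fg _ _ h

instance : (fpModules A).IsClosedUnderBinaryProducts where
  limitsOfShape_le := by
    rintro X ⟨p⟩
    have h₁ : Module.FinitePresentation A (p.diag.obj ⟨.left⟩) := p.prop_diag_obj _
    have h₂ : Module.FinitePresentation A (p.diag.obj ⟨.right⟩) := p.prop_diag_obj _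
    refine (fpModules A).prop_of_iso (((ModuleCat.binaryProductLimitCone (p.diag.obj ⟨.left⟩)
      (p.diag.obj ⟨.right⟩)).isLimit).conePointsIsoOfNatIso p.isLimit
      (diagramIsoPair p.diag).symm) ?_
    exact inferInstanceAs (Module.FinitePresentation A
      (p.diag.obj ⟨.left⟩ × p.diag.obj ⟨.right⟩))

instance : (fpModules A).IsClosedUnderFiniteProducts := .mk'

instance [IsLeftCoherent A] : PreservesFiniteLimits (fpModules A).ι :=
  have {X Y : (fpModules A).FullSubcategory} (f : X ⟶ Y) :
    PreservesLimit (parallelPair f 0) (fpModules A).ι := (fpModules A).preservesKernels_ι f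
  Functor.preservesFiniteLimits_of_preservesKernels _

instance [IsLeftCoherent A] : PreservesFiniteColimits (fpModules A).ι :=
  have {X Y : (fpModules A).FullSubcategory} (f : X ⟶ Y) :
    PreservesColimit (parallelPair f 0) (fpModules A).ι := (fpModules A).preservesCokernels_ι f
  Functor.preservesFiniteColimits_of_preservesCokernels _

end fp

section homcomplex
open CochainComplex.HomComplex
variable {C : Type u} [Category.{v} C] [Preadditive C] {R : Type v} [Ring R]
  {D : CochainComplex C ℤ} (ρ : R →+* End D)

/-- If `R` acts on the complex `D`, then `R` acts by postcomposition on the group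
`∏ p, Hom (M p, D (p + n))` of cochains of degree `n`. -/
abbrev cochainModule (M : CochainComplex C ℤ) (n : ℤ) : Module R (Cochain M D n) where
  smul r z := z.comp (Cochain.ofHom (ρ r)) (add_zero n)
  one_smul z := by
    change z.comp (Cochain.ofHom (ρ 1)) (add_zero n) = z
    rw [map_one]
    exact z.comp_id
  mul_smul r s z := by
    change z.comp (Cochain.ofHom (ρ (r * s))) (add_zero n) =
      (z.comp (Cochain.ofHom (ρ s)) (add_zero n)).comp (Cochain.ofHom (ρ r)) (add_zero n)
    rw [map_mul, End.mul_def, Cochain.ofHom_comp, Cochain.comp_assoc_of_third_is_zero_cochain]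
  smul_zero r := Cochain.zero_comp _ _
  smul_add r z₁ z₂ := Cochain.add_comp _ _ _ _
  add_smul r s z := by
    change z.comp (Cochain.ofHom (ρ (r + s))) (add_zero n) =
      z.comp (Cochain.ofHom (ρ r)) (add_zero n) + z.comp (Cochain.ofHom (ρ s)) (add_zero n)
    rw [map_add, ← Cochain.comp_add]
    exact congrArg (fun y ↦ z.comp y _) (Cochain.ofHom_add (ρ r) (ρ s))
  zero_smul z := by
    change z.comp (Cochain.ofHom (ρ 0)) (add_zero n) = 0
    rw [map_zero]
    exact (congrArg (fun y ↦ z.comp y _) (Cochain.ofHom_zero D D)).trans (z.comp_zero _)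

/-- The `R`-module of cochains of degree `n`. -/
def homComplexX (M : CochainComplex C ℤ) (n : ℤ) : ModuleCat.{v} R :=
  letI := cochainModule ρ M n
  ModuleCat.of R (Cochain M D n)

/-- The differential `z ↦ d ∘ z - (-1)ⁿ z ∘ d` on cochains of degree `n` (if `n + 1 = m`). -/
def homComplexD (M : CochainComplex C ℤ) (n m : ℤ) : homComplexX ρ M n ⟶ homComplexX ρ M m :=
  letI := cochainModule ρ M n
  letI := cochainModule ρ M m
  ModuleCat.ofHom (X := Cochain M D n) (Y := Cochain M D m)
    { toFun := fun z ↦ δ n m z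
      map_add' := fun z₁ z₂ ↦ δ_add _ _ z₁ z₂
      map_smul' := fun r z ↦ δ_comp_ofHom z (ρ r) m }

/-- The complex of `R`-modules `Hom(M, D)`, with terms `∏ p, Hom (M p, D (p + n))`. -/
def homComplex (M : CochainComplex C ℤ) : CochainComplex (ModuleCat.{v} R) ℤ where
  X n := homComplexX ρ M n
  d n m := homComplexD ρ M n m
  shape n m h := by
    ext z
    exact δ_shape n m h z
  d_comp_d' n₀ n₁ n₂ _ _ := by
    ext z
    exact δ_δ n₀ n₁ n₂ z

/-- The morphism `Hom(N, D) ⟶ Hom(M, D)` given by precomposition with `f : M ⟶ N`. -/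
def homComplexMap {M N : CochainComplex C ℤ} (f : M ⟶ N) :
    homComplex ρ N ⟶ homComplex ρ M where
  f n := letI := cochainModule ρ N n; letI := cochainModule ρ M n
    ModuleCat.ofHom (X := Cochain N D n) (Y := Cochain M D n)
    { toFun := fun z ↦ (Cochain.ofHom f).comp z (zero_add n)
      map_add' := fun z₁ z₂ ↦ Cochain.comp_add _ _ _ _
      map_smul' := fun r z ↦
        (Cochain.comp_assoc_of_third_is_zero_cochain (Cochain.ofHom f) z
          (Cochain.ofHom (ρ r)) (zero_add n)).symm }
  comm' n m _ := by
    ext z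
    exact δ_ofHom_comp (n := n) f z m

/-- The contravariant functor `Hom(-, D)` from complexes in `C` to complexes of `R`-modules. -/
def homComplexFunctor : (CochainComplex C ℤ)ᵒᵖ ⥤ CochainComplex (ModuleCat.{v} R) ℤ where
  obj M := homComplex ρ M.unop
  map f := homComplexMap ρ f.unop
  map_id M := by
    ext n z
    exact Cochain.id_comp (n := n) z
  map_comp {M N P} f g := by
    ext n z
    change (Cochain.ofHom (g.unop ≫ f.unop)).comp (z : Cochain M.unop D n) (zero_add n) = _
    rw [Cochain.ofHom_comp]
    exact Cochain.comp_assoc_of_first_is_zero_cochain (Cochain.ofHom g.unop)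
      (Cochain.ofHom f.unop) (z : Cochain M.unop D n) (zero_add n)

/-- The components `z ↦ (-1)ⁿ z ∘ h` of the homotopy on `Hom(-, D)` induced by a homotopy `h`. -/
noncomputable def homComplexHomotopyHom {M N : CochainComplex C ℤ} {f g : M ⟶ N}
    (h : Homotopy f g) (n m : ℤ) (hnm : m + 1 = n) :
    (homComplex ρ N).X n ⟶ (homComplex ρ M).X m :=
  letI := cochainModule ρ N n; letI := cochainModule ρ M m
  ModuleCat.ofHom (X := Cochain N D n) (Y := Cochain M D m)
    { toFun := fun z ↦ n.negOnePow • (Cochain.ofHomotopy h).comp z (by lia : -1 + n = m)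
      map_add' := fun z₁ z₂ ↦ by rw [Cochain.comp_add, smul_add]
      map_smul' := fun r z ↦ by
        change n.negOnePow • (Cochain.ofHomotopy h).comp
            (z.comp (Cochain.ofHom (ρ r)) (add_zero n)) (by lia : -1 + n = m) =
          (n.negOnePow • (Cochain.ofHomotopy h).comp z (by lia : -1 + n = m)).comp
            (Cochain.ofHom (ρ r)) (add_zero m)
        rw [Cochain.units_smul_comp, Cochain.comp_assoc_of_third_is_zero_cochain] }

/-- Homotopic morphisms induce homotopic morphisms on `Hom(-, D)`. -/
noncomputable def homComplexMapHomotopy {M N : CochainComplex C ℤ} {f g : M ⟶ N}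
    (h : Homotopy f g) : Homotopy (homComplexMap ρ f) (homComplexMap ρ g) where
  hom n m := if hnm : m + 1 = n then homComplexHomotopyHom ρ h n m hnm else 0
  zero n m hnm := dif_neg hnm
  comm n := by
    rw [dNext_eq _ (show (ComplexShape.up ℤ).Rel n (n + 1) from rfl),
      prevD_eq _ (show (ComplexShape.up ℤ).Rel (n - 1) n by simp),
      dif_pos rfl, dif_pos (by lia : n - 1 + 1 = n)]
    ext (z : Cochain N D n)
    change (Cochain.ofHom f).comp z (zero_add n) =
      (n + 1).negOnePow • (Cochain.ofHomotopy h).comp (δ n (n + 1) z) (by lia) +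
        δ (n - 1) n (n.negOnePow • (Cochain.ofHomotopy h).comp z (by lia : -1 + n = n - 1)) +
        (Cochain.ofHom g).comp z (zero_add n)
    rw [δ_units_smul, δ_comp (Cochain.ofHomotopy h) z (by lia : -1 + n = n - 1) 0 (n + 1) n
      (by lia) (by lia) (by lia), δ_ofHomotopy, Cochain.sub_comp, Int.negOnePow_succ, smul_add,
      smul_smul, Int.units_mul_self, one_smul, Units.neg_smul]
    abel

/-- The functor `Hom(-, D)` on homotopy categories. -/
noncomputable def homHotFunctor :
    (HomotopyCategory C (.up ℤ))ᵒᵖ ⥤ HomotopyCategory (ModuleCat.{v} R) (.up ℤ) :=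
  (CategoryTheory.Quotient.lift _
    (homComplexFunctor ρ ⋙ HomotopyCategory.quotient (ModuleCat.{v} R) (.up ℤ)).rightOp
    (fun _ _ _ _ ⟨h⟩ ↦ congrArg Quiver.Hom.op
      (HomotopyCategory.eq_of_homotopy _ _ (homComplexMapHomotopy ρ h)))).leftOp

end homcomplex

section res
variable (C : Type u) [Category.{v} C] [Abelian C]

/-- Bounded above complexes of projective objects, in the homotopy category of complexes. -/
def projMinus : ObjectProperty (HomotopyCategory C (.up ℤ)) :=
  fun P ↦ (∃ n : ℤ, CochainComplex.IsStrictlyLE P.as n) ∧ ∀ i, Projective (P.as.X i)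

variable {C} in
lemma exists_projective_resolution [EnoughProjectives C] (K : CochainComplex C ℤ) (n : ℤ)
    [K.IsStrictlyLE n] :
    ∃ (P : CochainComplex C ℤ) (f : P ⟶ K), P.IsStrictlyLE n ∧ (∀ i, Projective (P.X i)) ∧
      QuasiIso f := by
  let e := CochainComplex.opEquivalence C
  have : (e.functor.obj (op K)).IsStrictlyGE (-n) := by
    rw [CochainComplex.isStrictlyGE_iff]
    intro i hi
    exact (K.isZero_of_isStrictlyLE n (-i) (by lia)).op
  obtain ⟨L, i, _, hL, _⟩ :=
    CochainComplex.Plus.modelCategoryQuillen.exists_quasiIso_injective (e.functor.obj (op K)) (-n)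
  let g : (e.inverse.obj L).unop ⟶ (e.inverse.obj (e.functor.obj (op K))).unop :=
    (e.inverse.map i).unop
  have hg : QuasiIso g := ⟨fun q ↦ by
    rw [quasiIsoAt_iff' g (q - 1) q (q + 1) (by simp) (by simp),
      ← ShortComplex.quasiIso_opMap_iff]
    exact (quasiIsoAt_iff' i (-(q + 1)) (-q) (-(q - 1)) (by simp; lia) (by simp; lia)).1
      inferInstance⟩
  refine ⟨(e.inverse.obj L).unop, g ≫ (e.unitIso.hom.app (op K)).unop, ?_, fun q ↦ ?_, ?_⟩
  · rw [CochainComplex.isStrictlyLE_iff]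
    intro q hq
    exact (L.isZero_of_isStrictlyGE (-n) (-q) (by lia)).unop
  · exact inferInstanceAs (Projective (L.X (-q)).unop)
  · infer_instance

variable [HasDerivedCategory.{w} C]

/-- The canonical functor from the homotopy category of bounded above complexes of projectives
to the bounded above derived category. -/
noncomputable def projMinusToMinus :
    (projMinus C).FullSubcategory ⥤ DerivedCategory.Minus C :=
  ObjectProperty.lift _ ((projMinus C).ι ⋙ DerivedCategory.Qh) (by
    rintro ⟨P, ⟨n, hn⟩, _⟩
    obtain ⟨P : CochainComplex C ℤ, rfl⟩ := HomotopyCategory.quotient_obj_surjective P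
    have : P.IsStrictlyLE n := hn
    exact ⟨n, DerivedCategory.TStructure.t.isLE_of_iso
      ((DerivedCategory.quotientCompQhIso C).symm.app P) n⟩)

instance [EnoughProjectives C] : (projMinusToMinus C).EssSurj where
  mem_essImage := by
    rintro ⟨X, n, K, e, _⟩
    obtain ⟨P, f, h₁, h₂, _⟩ := exists_projective_resolution K n
    refine ⟨⟨(HomotopyCategory.quotient _ _).obj P, ⟨n, h₁⟩, h₂⟩,
      ⟨DerivedCategory.Minus.ι.preimageIso ?_⟩⟩
    exact (DerivedCategory.quotientCompQhIso C).app P ≪≫ asIso (DerivedCategory.Q.map f) ≪≫ e.symm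

lemma projMinusToMinus_map_bijective (P P' : (projMinus C).FullSubcategory) :
    Function.Bijective ((projMinusToMinus C).map : (P ⟶ P') → _) := by
  obtain ⟨P, ⟨n, hn⟩, hP⟩ := P
  have := CochainComplex.isKProjective_of_projective P.as n
  have h := (CochainComplex.IsKProjective.Qh_map_bijective P.as P'.obj).comp
    ((projMinus C).fullyFaithfulι.map_bijective ⟨P, ⟨n, hn⟩, hP⟩ P')
  rwa [← Function.Bijective.of_comp_iff'
    (DerivedCategory.TStructure.t.minus.fullyFaithfulι.map_bijective _ _)]

instance : (projMinusToMinus C).Full where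
  map_surjective := (projMinusToMinus_map_bijective C _ _).2

instance : (projMinusToMinus C).Faithful where
  map_injective h := (projMinusToMinus_map_bijective C _ _).1 h

instance [EnoughProjectives C] : (projMinusToMinus C).IsEquivalence where

/-- The right derived functor `RHom(-, D)` on the bounded above derived category, where
`R` acts on `D`: replace a complex by a bounded above complex of projectives, and apply
`Hom(-, D)`. -/
noncomputable def rHom [EnoughProjectives C] {R : Type v} [Ring R]
    [HasDerivedCategory.{w} (ModuleCat.{v} R)]
    {D : CochainComplex C ℤ} (ρ : R →+* End D) :
    (DerivedCategory.Minus C)ᵒᵖ ⥤ DerivedCategory (ModuleCat.{v} R) :=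
  (projMinusToMinus C).inv.op ⋙ (projMinus C).ι.op ⋙ homHotFunctor ρ ⋙ DerivedCategory.Qh

end res

section bimodules

/-- If `φ : A →+* S` and `ψ : R →+* S` have commuting images, then `R` acts through `ψ` on the
complex of `A`-modules underlying a complex of `S`-modules. -/
noncomputable def actionHom {A R S : Type u} [Ring A] [Ring R] [Ring S] (φ : A →+* S) (ψ : R →+* S)
    (h : ∀ a r, Commute (φ a) (ψ r)) (D : CochainComplex (ModuleCat.{u} S) ℤ) :
    R →+* End (((ModuleCat.restrictScalars.{u} φ).mapHomologicalComplex (.up ℤ)).obj D) where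
  toFun r :=
    { f := fun n ↦ ModuleCat.ofHom
        (X := (ModuleCat.restrictScalars.{u} φ).obj (D.X n))
        (Y := (ModuleCat.restrictScalars.{u} φ).obj (D.X n))
        { toFun := fun x ↦ (ψ r • (x : D.X n) : D.X n)
          map_add' := fun x y ↦ smul_add (ψ r) (x : D.X n) (y : D.X n)
          map_smul' := fun a x ↦ by
            change ψ r • φ a • (x : D.X n) = φ a • ψ r • (x : D.X n)
            rw [smul_smul, smul_smul, (h a r).eq] }
      comm' := fun i j _ ↦ by
        ext (x : D.X i)
        exact map_smul (D.d i j).hom (ψ r) x }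
  map_one' := by
    refine HomologicalComplex.hom_ext _ _ fun n ↦
      ModuleCat.hom_ext (LinearMap.ext fun (x : D.X n) ↦ ?_)
    change ψ 1 • x = x
    rw [map_one, one_smul]
  map_mul' r s := by
    refine HomologicalComplex.hom_ext _ _ fun n ↦
      ModuleCat.hom_ext (LinearMap.ext fun (x : D.X n) ↦ ?_)
    change ψ (r * s) • x = ψ r • ψ s • x
    rw [map_mul, mul_smul]
  map_zero' := by
    refine HomologicalComplex.hom_ext _ _ fun n ↦
      ModuleCat.hom_ext (LinearMap.ext fun (x : D.X n) ↦ ?_)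
    change ψ 0 • x = 0
    rw [map_zero, zero_smul]
  map_add' r s := by
    refine HomologicalComplex.hom_ext _ _ fun n ↦
      ModuleCat.hom_ext (LinearMap.ext fun (x : D.X n) ↦ ?_)
    change ψ (r + s) • x = ψ r • x + ψ s • x
    rw [map_add, add_smul]

variable {A B : Type u} [Ring A] [Ring B]

/-- The category of `A`-`B`-bimodules, as left modules over `A ⊗ Bᵐᵒᵖ`. (Right `B`-modules are
regarded as left `Bᵐᵒᵖ`-modules throughout.) -/
abbrev BimodCat (A B : Type u) [Ring A] [Ring B] := ModuleCat.{u} (A ⊗[ℤ] Bᵐᵒᵖ)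

/-- The ring homomorphism `a ↦ a ⊗ 1`. -/
abbrev bimodLeft (A B : Type u) [Ring A] [Ring B] : A →+* A ⊗[ℤ] Bᵐᵒᵖ :=
  (Algebra.TensorProduct.includeLeft : A →ₐ[ℤ] A ⊗[ℤ] Bᵐᵒᵖ).toRingHom

/-- The ring homomorphism `b ↦ 1 ⊗ b`. -/
abbrev bimodRight (A B : Type u) [Ring A] [Ring B] : Bᵐᵒᵖ →+* A ⊗[ℤ] Bᵐᵒᵖ :=
  (Algebra.TensorProduct.includeRight : Bᵐᵒᵖ →ₐ[ℤ] A ⊗[ℤ] Bᵐᵒᵖ).toRingHom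

lemma commute_bimodLeft_bimodRight (a : A) (b : Bᵐᵒᵖ) :
    Commute (bimodLeft A B a) (bimodRight A B b) := by
  change (a ⊗ₜ[ℤ] (1 : Bᵐᵒᵖ)) * ((1 : A) ⊗ₜ[ℤ] b) = ((1 : A) ⊗ₜ[ℤ] b) * (a ⊗ₜ[ℤ] (1 : Bᵐᵒᵖ))
  simp

/-- The complex of left `A`-modules underlying a complex of bimodules. -/
noncomputable abbrev leftComplex (D : CochainComplex (BimodCat A B) ℤ) :
    CochainComplex (ModuleCat.{u} A) ℤ :=
  ((ModuleCat.restrictScalars.{u} (bimodLeft A B)).mapHomologicalComplex (.up ℤ)).obj D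

/-- The complex of right `B`-modules underlying a complex of bimodules. -/
noncomputable abbrev rightComplex (D : CochainComplex (BimodCat A B) ℤ) :
    CochainComplex (ModuleCat.{u} Bᵐᵒᵖ) ℤ :=
  ((ModuleCat.restrictScalars.{u} (bimodRight A B)).mapHomologicalComplex (.up ℤ)).obj D

/-- The action of `Bᵐᵒᵖ` on `D` by endomorphisms of complexes of left `A`-modules. -/
noncomputable def rightAction (D : CochainComplex (BimodCat A B) ℤ) :
    Bᵐᵒᵖ →+* End (leftComplex D) :=
  actionHom (bimodLeft A B) (bimodRight A B) commute_bimodLeft_bimodRight D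

/-- The action of `A` on `D` by endomorphisms of complexes of right `B`-modules. -/
noncomputable def leftAction (D : CochainComplex (BimodCat A B) ℤ) :
    A →+* End (rightComplex D) :=
  actionHom (bimodRight A B) (bimodLeft A B)
    (fun b a ↦ (commute_bimodLeft_bimodRight a b).symm) D

/-- A complex is quasi-isomorphic to a finite complex of injective objects. -/
def HasFiniteInjectiveModel {C : Type v} [Category.{u} C] [Abelian C] [HasDerivedCategory.{w} C]
    (K : CochainComplex C ℤ) : Prop :=
  ∃ (I : CochainComplex C ℤ) (a b : ℤ), I.IsStrictlyGE a ∧ I.IsStrictlyLE b ∧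
    (∀ n, Injective (I.X n)) ∧ Nonempty (DerivedCategory.Q.obj K ≅ DerivedCategory.Q.obj I)

/-- If `R` acts on the complex `K`, the homothety map `R → Hom(K, K[*])` to the graded ring of
endomorphisms of `K` in the derived category is an isomorphism, where `R` is placed in
degree zero. -/
structure IsHomothetyIso {C : Type v} [Category.{u} C] [Abelian C] [HasDerivedCategory.{w} C]
    {R : Type u} [Ring R] {K : CochainComplex C ℤ} (ρ : R →+* End K) : Prop where
  bijective : Function.Bijective fun r ↦
    (DerivedCategory.Q.map (ρ r) : DerivedCategory.Q.obj K ⟶ DerivedCategory.Q.obj K)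
  eq_zero (n : ℤ) (hn : n ≠ 0) (f : DerivedCategory.Q.obj K ⟶ (DerivedCategory.Q.obj K)⟦n⟧) :
    f = 0

/-- A complex `D` of `A`-`B`-bimodules is a weak dualizing complex. -/
structure IsWeakDualizingComplex [HasDerivedCategory.{w} (ModuleCat.{u} A)]
    [HasDerivedCategory.{w} (ModuleCat.{u} Bᵐᵒᵖ)]
    (D : CochainComplex (BimodCat A B) ℤ) : Prop where
  left_injective : HasFiniteInjectiveModel (leftComplex D)
  right_injective : HasFiniteInjectiveModel (rightComplex D)
  left_finitePresentation (n : ℤ) :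
    Module.FinitePresentation A
      ((ModuleCat.restrictScalars.{u} (bimodLeft A B)).obj (D.homology n))
  right_finitePresentation (n : ℤ) :
    Module.FinitePresentation Bᵐᵒᵖ
      ((ModuleCat.restrictScalars.{u} (bimodRight A B)).obj (D.homology n))
  left_homothety : IsHomothetyIso (leftAction D)
  right_homothety : IsHomothetyIso (rightAction D)

/-- The derived functor `RHom_A(-, D)` from the bounded above derived category of left `A`-modules
to the derived category of right `B`-modules. -/
noncomputable def rHomLeft [HasDerivedCategory.{w} (ModuleCat.{u} A)]
    [HasDerivedCategory.{w} (ModuleCat.{u} Bᵐᵒᵖ)] (D : CochainComplex (BimodCat A B) ℤ) :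
    (DerivedCategory.Minus (ModuleCat.{u} A))ᵒᵖ ⥤ DerivedCategory (ModuleCat.{u} Bᵐᵒᵖ) :=
  rHom _ (rightAction D)

/-- The derived functor `RHom_{Bᵐᵒᵖ}(-, D)` from the bounded above derived category of right
`B`-modules to the derived category of left `A`-modules. -/
noncomputable def rHomRight [HasDerivedCategory.{w} (ModuleCat.{u} A)]
    [HasDerivedCategory.{w} (ModuleCat.{u} Bᵐᵒᵖ)] (D : CochainComplex (BimodCat A B) ℤ) :
    (DerivedCategory.Minus (ModuleCat.{u} Bᵐᵒᵖ))ᵒᵖ ⥤ DerivedCategory (ModuleCat.{u} A) :=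
  rHom _ (leftAction D)

end bimodules

section fpDerived

variable (A : Type u) [Ring A] [IsLeftCoherent A] [HasDerivedCategory.{w} (ModuleCat.{u} A)]
  [HasDerivedCategory.{w} (FpModuleCat A)]

/-- The functor `Dᵇ(A-mod_fp) ⥤ D⁻(A-mod)` induced by the inclusion `A-mod_fp ⥤ A-mod`. -/
noncomputable def fpToMinus :
    DerivedCategory.Bounded (FpModuleCat A) ⥤ DerivedCategory.Minus (ModuleCat.{u} A) :=
  ObjectProperty.lift _
    (DerivedCategory.Bounded.ι ⋙ (fpModules A).ι.mapDerivedCategory) (by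
      rintro ⟨X, _, n, K, e, _⟩
      exact ⟨n, ((fpModules A).ι.mapHomologicalComplex (.up ℤ)).obj K,
        (fpModules A).ι.mapDerivedCategory.mapIso e ≪≫
          (fpModules A).ι.mapDerivedCategoryFactors.app K, inferInstance⟩)

end fpDerived

/-! A bilinear pairing of complexes M × N → D can be read as N → Hom_A(M, D) or as M → Hom_{B^op}(N,
D). On derived categories this transposition turns Y → RHom_A(X, D) into X → RHom_{B^op}(Y, D),
naturally in both variables. Suppose that it takes isomorphisms to isomorphisms, in both directions,
and that both functors land in the images of the two categories D^b of finitely presented modules.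
Then transposing the identifications of the lifted functors with the derived ones gives the two
natural isomorphisms of an anti-equivalence (`exists_equivalence_of_transposition`).

The transpose of an isomorphism is an isomorphism as soon as the biduality map of X is one
(`quasiIso_homTranspose_iff`). To have biduality on complexes, replace the outer D by a K-injective
complex J of injective B^op-modules quasi-isomorphic to D. This loses the A-action, so M →
Hom(Hom(M, D), J) is only a map of complexes of abelian groups, which suffices for testing
quasi-isomorphisms. For M = A it is the homothety map, up to isomorphism
(`quasiIso_biduality_singleRing`). Closure under retracts and two-out-of-three extends this to
bounded complexes of finitely generated projectives (`ContainsPerfect.of_bounded`).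

An object of D^b(A-mod_fp) is represented by a complex P of finitely generated projectives, bounded
above but in general not below. Since D is bounded below and has finite injective dimension, the
double dual of the brutal truncation of P in degrees < N lies in very negative degrees when N does,
so a given degree only sees a bounded part of P (`IsFinProj.quasiIso_biduality`). The same way-out
argument, starting from Hom(A, D) ≅ D, makes the cohomology of RHom(P, D) finitely presented
(`IsFinProj.hasFpHomology_homComplex`).

By coherence, D^b of finitely presented modules embeds fully faithfully in the derived category of
all modules (`FpModuleCat.mapDerivedCategory_map_bijective`), and its image contains all bounded
objects with finitely presented cohomology (`essImage_of_isGE_of_isLE`).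

Everything is done for rings R and S mapping to T with commuting images, so that each lemma serves
both directions. -/

/-! ### Morphisms into Hom complexes and their transposition -/

section homVal
open CochainComplex.HomComplex
variable {C : Type u} [Category.{v} C] [Preadditive C] {R : Type v} [Ring R]
  {D : CochainComplex C ℤ} (ρ : R →+* End D)

/-- The cochains which are the values of a morphism `N ⟶ Hom(M, D)`. -/
def homVal {M : CochainComplex C ℤ} {N : CochainComplex (ModuleCat.{v} R) ℤ}
    (g : N ⟶ homComplex ρ M) (p : ℤ) : N.X p →+ Cochain M D p :=
  (g.f p).hom.toAddMonoidHom

lemma homVal_smul {M : CochainComplex C ℤ} {N : CochainComplex (ModuleCat.{v} R) ℤ}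
    (g : N ⟶ homComplex ρ M) (p : ℤ) (r : R) (y : N.X p) :
    homVal ρ g p (r • y) = (homVal ρ g p y).comp (Cochain.ofHom (ρ r)) (add_zero p) :=
  map_smul (g.f p).hom r y

lemma homVal_d {M : CochainComplex C ℤ} {N : CochainComplex (ModuleCat.{v} R) ℤ}
    (g : N ⟶ homComplex ρ M) (p q : ℤ) (y : N.X p) :
    homVal ρ g q (N.d p q y) = δ p q (homVal ρ g p y) :=
  (ConcreteCategory.congr_hom (g.comm p q) y).symm

/-- Constructor for morphisms `N ⟶ Hom(M, D)`. -/
def homComplexLift {M : CochainComplex C ℤ} {N : CochainComplex (ModuleCat.{v} R) ℤ}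
    (g : ∀ p, N.X p →+ Cochain M D p)
    (hg : ∀ p (r : R) y, g p (r • y) = (g p y).comp (Cochain.ofHom (ρ r)) (add_zero p))
    (hd : ∀ p y, g (p + 1) (N.d p (p + 1) y) = δ p (p + 1) (g p y)) :
    N ⟶ homComplex ρ M where
  f p := letI := cochainModule ρ M p
    ModuleCat.ofHom (X := N.X p) (Y := Cochain M D p) { g p with map_smul' := hg p }
  comm' p q hpq := by
    obtain rfl : p + 1 = q := hpq
    ext y
    exact (hd p y).symm

lemma homVal_ext {M : CochainComplex C ℤ} {N : CochainComplex (ModuleCat.{v} R) ℤ}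
    {g g' : N ⟶ homComplex ρ M} (h : ∀ p y, homVal ρ g p y = homVal ρ g' p y) : g = g' := by
  ext p y
  exact h p y

lemma homVal_comp {M : CochainComplex C ℤ} {N N' : CochainComplex (ModuleCat.{v} R) ℤ}
    (f : N' ⟶ N) (g : N ⟶ homComplex ρ M) (p : ℤ) (y : N'.X p) :
    homVal ρ (f ≫ g) p y = homVal ρ g p (f.f p y) := rfl

lemma homVal_comp_homComplexMap {M M' : CochainComplex C ℤ} {N : CochainComplex (ModuleCat.{v} R) ℤ}
    (g : N ⟶ homComplex ρ M) (f : M' ⟶ M) (p : ℤ) (y : N.X p) :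
    homVal ρ (g ≫ homComplexMap ρ f) p y = (Cochain.ofHom f).comp (homVal ρ g p y) (zero_add p) :=
  rfl

end homVal

section transpose
open CochainComplex.HomComplex
variable {R S T : Type u} [Ring R] [Ring S] [Ring T] {φ : R →+* T} {ψ : S →+* T}
  (h : ∀ a r, Commute (φ a) (ψ r)) (h' : ∀ r a, Commute (ψ r) (φ a))
  {D : CochainComplex (ModuleCat.{u} T) ℤ}

/-- The complex obtained by restricting scalars termwise. -/
noncomputable abbrev resComplex (φ : R →+* T) (D : CochainComplex (ModuleCat.{u} T) ℤ) :
    CochainComplex (ModuleCat.{u} R) ℤ :=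
  ((ModuleCat.restrictScalars.{u} φ).mapHomologicalComplex (.up ℤ)).obj D

/-- The value of a cochain with values in a complex of `T`-modules. -/
noncomputable def cochainEval {M : CochainComplex (ModuleCat.{u} R) ℤ} {n : ℤ}
    (p q : ℤ) (hpq : p + n = q) :
    Cochain M (resComplex φ D) n →+ M.X p →+ D.X q where
  toFun z := (z.v p q hpq).hom.toAddMonoidHom
  map_zero' := rfl
  map_add' _ _ := rfl

lemma cochainEval_ext {M : CochainComplex (ModuleCat.{u} R) ℤ} {n : ℤ}
    {z z' : Cochain M (resComplex φ D) n}
    (hz : ∀ p q hpq x, cochainEval p q hpq z x = cochainEval p q hpq z' x) : z = z' := by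
  ext p q hpq x
  exact hz p q hpq x

lemma cochainEval_smul_right {M : CochainComplex (ModuleCat.{u} R) ℤ} {n : ℤ}
    (p q : ℤ) (hpq : p + n = q) (z : Cochain M (resComplex φ D) n) (r : R) (x : M.X p) :
    cochainEval p q hpq z (r • x) = φ r • cochainEval p q hpq z x :=
  (z.v p q hpq).hom.map_smul r x

lemma cochainEval_smul_left {M : CochainComplex (ModuleCat.{u} R) ℤ} {n : ℤ}
    (p q : ℤ) (hpq : p + n = q) (z : Cochain M (resComplex φ D) n) (s : S) (x : M.X p) :
    cochainEval p q hpq (z.comp (Cochain.ofHom (actionHom φ ψ h D s)) (add_zero n)) x =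
      ψ s • cochainEval p q hpq z x := by
  change ((z.comp (Cochain.ofHom (actionHom φ ψ h D s)) (add_zero n)).v p q hpq) x = _
  rw [Cochain.comp_zero_cochain_v]
  rfl

lemma cochainEval_ofHom_comp {M M' : CochainComplex (ModuleCat.{u} R) ℤ} {n : ℤ}
    (p q : ℤ) (hpq : p + n = q) (z : Cochain M (resComplex φ D) n) (f : M' ⟶ M) (x : M'.X p) :
    cochainEval p q hpq ((Cochain.ofHom f).comp z (zero_add n)) x =
      cochainEval p q hpq z (f.f p x) := by
  change (((Cochain.ofHom f).comp z (zero_add n)).v p q hpq) x = _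
  rw [Cochain.zero_cochain_comp_v]
  rw [Cochain.ofHom_v]
  rfl

lemma cochainEval_δ {M : CochainComplex (ModuleCat.{u} R) ℤ} {n m : ℤ} (hnm : n + 1 = m)
    (p q : ℤ) (hpq : p + m = q) (q₁ p₂ : ℤ) (h₁ : p + n = q₁) (h₂ : p₂ + n = q)
    (hp : p + 1 = p₂) (z : Cochain M (resComplex φ D) n) (x : M.X p) :
    cochainEval p q hpq (δ n m z) x =
      D.d q₁ q (cochainEval p q₁ h₁ z x) +
        m.negOnePow • cochainEval p₂ q h₂ z (M.d p p₂ x) := by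
  change ((δ n m z).v p q hpq) x = _
  rw [δ_v n m hnm z p q hpq q₁ p₂ (by lia) hp]
  rfl

/-- The cochains which are the values of the transpose of a morphism `N ⟶ Hom(M, D)`. -/
noncomputable def homTransposeVal {M : CochainComplex (ModuleCat.{u} R) ℤ}
    {N : CochainComplex (ModuleCat.{u} S) ℤ}
    (g : N ⟶ homComplex (actionHom φ ψ h D) M) (i : ℤ) :
    M.X i →+ Cochain N (resComplex ψ D) i where
  toFun x := Cochain.mk fun p q hpq ↦
    ModuleCat.ofHom (X := N.X p) (Y := (ModuleCat.restrictScalars.{u} ψ).obj (D.X q))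
      { toFun := fun y ↦ ((i * p).negOnePow • cochainEval i q (by lia) (homVal _ g p y) x : D.X q)
        map_add' := fun y y' ↦ by
          rw [map_add, map_add, AddMonoidHom.add_apply]
          exact smul_add _ _ _
        map_smul' := fun s y ↦ by
          rw [homVal_smul, cochainEval_smul_left]
          exact (smul_comm (α := D.X q) (ψ s) ((i * p).negOnePow) _).symm }
  map_zero' := by
    refine cochainEval_ext fun p q hpq y ↦ ?_
    change (i * p).negOnePow • cochainEval i q _ (homVal _ g p y) 0 = 0
    rw [map_zero, smul_zero]
  map_add' := fun x x' ↦ by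
    refine cochainEval_ext fun p q hpq y ↦ ?_
    rw [map_add, AddMonoidHom.add_apply]
    change (i * p).negOnePow • cochainEval i q _ (homVal _ g p y) (x + x') =
      (i * p).negOnePow • cochainEval i q _ (homVal _ g p y) x +
        (i * p).negOnePow • cochainEval i q _ (homVal _ g p y) x'
    rw [map_add, smul_add]

lemma cochainEval_homTransposeVal {M : CochainComplex (ModuleCat.{u} R) ℤ}
    {N : CochainComplex (ModuleCat.{u} S) ℤ}
    (g : N ⟶ homComplex (actionHom φ ψ h D) M) (i p q : ℤ) (hpq : p + i = q) (x : M.X i)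
    (y : N.X p) :
    cochainEval p q hpq (homTransposeVal h g i x) y =
      (i * p).negOnePow • cochainEval i q (by lia) (homVal _ g p y) x := rfl

/-- A morphism `N ⟶ Hom(M, D)` induces a morphism `M ⟶ Hom(N, D)`. -/
noncomputable def homTranspose {M : CochainComplex (ModuleCat.{u} R) ℤ}
    {N : CochainComplex (ModuleCat.{u} S) ℤ}
    (g : N ⟶ homComplex (actionHom φ ψ h D) M) :
    M ⟶ homComplex (actionHom ψ φ h' D) N :=
  homComplexLift _ (homTransposeVal h g)
    (fun i r x ↦ by
      refine cochainEval_ext fun p q hpq y ↦ ?_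
      rw [cochainEval_smul_left, cochainEval_homTransposeVal, cochainEval_homTransposeVal,
        cochainEval_smul_right]
      exact (smul_comm (α := D.X q) (φ r) ((i * p).negOnePow) _).symm)
    (fun i x ↦ by
      refine cochainEval_ext fun p q hpq (y : N.X p) ↦ ?_
      rw [cochainEval_δ rfl p q hpq (p + i) (p + 1) rfl (by lia) rfl,
        cochainEval_homTransposeVal, cochainEval_homTransposeVal, cochainEval_homTransposeVal,
        homVal_d, cochainEval_δ rfl i q (by lia) (p + i) (i + 1) (by lia) (by lia) rfl]
      have e2 : D.d (p + i) q ((i * p).negOnePow •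
          cochainEval i (p + i) (by lia) (homVal _ g p y) x) =
          (i * p).negOnePow • D.d (p + i) q (cochainEval i (p + i) (by lia)
              (homVal _ g p y) x) := by
        rw [Units.smul_def, Units.smul_def]
        exact map_zsmul (D.d (p + i) q).hom _ _
      rw [e2]
      generalize (D.d (p + i) q) (cochainEval i (p + i) _ (homVal _ g p y) x) = a
      generalize cochainEval (i + 1) q _ (homVal _ g p y) (M.d i (i + 1) x) = b
      -- The sign (-1)^(ip) is the one compatible with differentials: i + 1 + i(p + 1) has the
      -- parity of ip + 1, and ip + p + 1 = (i + 1)p + 1.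
      have s1 : (i + 1).negOnePow * (i * (p + 1)).negOnePow = - (i * p).negOnePow := by
        rw [← Int.negOnePow_add, show i + 1 + i * (p + 1) = i * p + (i + i) + 1 by ring,
          Int.negOnePow_succ, Int.negOnePow_add _ (i + i), Int.negOnePow_even _ ⟨i, rfl⟩, mul_one]
      have s2 : (i * p).negOnePow * (p + 1).negOnePow = - ((i + 1) * p).negOnePow := by
        rw [← Int.negOnePow_add, show i * p + (p + 1) = (i + 1) * p + 1 by ring,
          Int.negOnePow_succ]
      rw [smul_smul (i + 1).negOnePow, s1, smul_add, smul_smul, neg_mul, s2, neg_neg,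
        Units.neg_smul]
      abel)

lemma cochainEval_homTranspose {M : CochainComplex (ModuleCat.{u} R) ℤ}
    {N : CochainComplex (ModuleCat.{u} S) ℤ}
    (g : N ⟶ homComplex (actionHom φ ψ h D) M) (i p q : ℤ) (hpq : p + i = q) (x : M.X i)
    (y : N.X p) :
    cochainEval p q hpq (homVal _ (homTranspose h h' g) i x) y =
      (i * p).negOnePow • cochainEval i q (by lia) (homVal _ g p y) x := rfl

lemma hom_homComplex_ext {M : CochainComplex (ModuleCat.{u} R) ℤ}
    {N : CochainComplex (ModuleCat.{u} S) ℤ}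
    {g g' : N ⟶ homComplex (actionHom φ ψ h D) M}
    (hg : ∀ p i q (hq : i + p = q) y x, cochainEval i q hq (homVal _ g p y) x =
      cochainEval i q hq (homVal _ g' p y) x) : g = g' :=
  homVal_ext _ fun p y ↦ cochainEval_ext fun i q hq x ↦ hg p i q hq y x

-- The sign (-1)^(ip) is symmetric in i and p and squares to one.
@[simp]
lemma homTranspose_homTranspose {M : CochainComplex (ModuleCat.{u} R) ℤ}
    {N : CochainComplex (ModuleCat.{u} S) ℤ}
    (g : N ⟶ homComplex (actionHom φ ψ h D) M) :
    homTranspose h' h (homTranspose h h' g) = g := by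
  refine hom_homComplex_ext h fun p i q hq y x ↦ ?_
  rw [cochainEval_homTranspose, cochainEval_homTranspose, smul_smul, mul_comm p i,
    Int.units_mul_self, one_smul]

lemma homTranspose_comp_left {M : CochainComplex (ModuleCat.{u} R) ℤ}
    {N N' : CochainComplex (ModuleCat.{u} S) ℤ} (f : N' ⟶ N)
    (g : N ⟶ homComplex (actionHom φ ψ h D) M) :
    homTranspose h h' (f ≫ g) = homTranspose h h' g ≫ homComplexMap (actionHom ψ φ h' D) f := by
  refine hom_homComplex_ext h' fun p i q hq y x ↦ ?_
  rw [homVal_comp_homComplexMap, cochainEval_ofHom_comp, cochainEval_homTranspose,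
    cochainEval_homTranspose, homVal_comp]

/-- Since transposition is an involution, naturality in M is naturality in the other variable for
the reverse transposition. -/
lemma homTranspose_comp_right {M M' : CochainComplex (ModuleCat.{u} R) ℤ}
    {N : CochainComplex (ModuleCat.{u} S) ℤ} (f : M' ⟶ M)
    (g : N ⟶ homComplex (actionHom φ ψ h D) M) :
    homTranspose h h' (g ≫ homComplexMap (actionHom φ ψ h D) f) = f ≫ homTranspose h h' g := by
  conv_lhs => rw [← homTranspose_homTranspose h h' (g := g), ← homTranspose_comp_left h' h]
  rw [homTranspose_homTranspose]

end transpose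

/-! ### Elementwise criteria for exactness and quasi-isomorphisms -/

section modules
variable {R : Type v} [Ring R]

lemma ModuleCat.exactAt_iff (K : CochainComplex (ModuleCat.{u} R) ℤ) (n : ℤ) :
    K.ExactAt n ↔ ∀ x : K.X n, K.d n (n + 1) x = 0 → ∃ y, K.d (n - 1) n y = x := by
  rw [K.exactAt_iff' (n - 1) n (n + 1) (by simp) (by simp), ShortComplex.moduleCat_exact_iff]
  rfl

/-- `h₁` is injectivity and `h₂` surjectivity on cohomology. Phrased with cochains, the criterion
applies to Hom complexes without computing their cohomology objects. -/
lemma ModuleCat.quasiIsoAt_of_forall {K L : CochainComplex (ModuleCat.{u} R) ℤ} (f : K ⟶ L) (n : ℤ)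
    (h₁ : ∀ x : K.X n, K.d n (n + 1) x = 0 → ∀ y, L.d (n - 1) n y = f.f n x →
      ∃ y, K.d (n - 1) n y = x)
    (h₂ : ∀ w : L.X n, L.d n (n + 1) w = 0 → ∃ x, K.d n (n + 1) x = 0 ∧
      ∃ y, L.d (n - 1) n y = f.f n x - w) : QuasiIsoAt f n := by
  have hn : (ComplexShape.up ℤ).prev n = n - 1 := by simp
  have hn' : (ComplexShape.up ℤ).next n = n + 1 := by simp
  have surj {K : CochainComplex (ModuleCat.{u} R) ℤ} (z : K.homology n) :
      ∃ c, K.homologyπ n c = z :=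
    (ModuleCat.epi_iff_surjective _).1 inferInstance z
  have inj {K : CochainComplex (ModuleCat.{u} R) ℤ} :
      Function.Injective (K.iCycles n) := (ModuleCat.mono_iff_injective _).1 inferInstance
  have dz {K : CochainComplex (ModuleCat.{u} R) ℤ} (c : K.cycles n) :
      K.d n (n + 1) (K.iCycles n c) = 0 :=
    ConcreteCategory.congr_hom (K.iCycles_d n (n + 1)) c
  have bd {K : CochainComplex (ModuleCat.{u} R) ℤ} (c : K.cycles n) (y : K.X (n - 1))
      (hy : K.d (n - 1) n y = K.iCycles n c) : K.homologyπ n c = 0 := by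
    have : K.toCycles (n - 1) n y = c := inj (by
      rw [← hy]
      exact ConcreteCategory.congr_hom (K.toCycles_i (n - 1) n) y)
    rw [← this]
    exact ConcreteCategory.congr_hom (K.toCycles_comp_homologyπ (n - 1) n) y
  have bd' {K : CochainComplex (ModuleCat.{u} R) ℤ} (c : K.cycles n) (hc : K.homologyπ n c = 0) :
      ∃ y, K.d (n - 1) n y = K.iCycles n c := by
    have hex : (ShortComplex.mk (K.toCycles (n - 1) n) (K.homologyπ n)
        (K.toCycles_comp_homologyπ (n - 1) n)).Exact :=
      ShortComplex.exact_of_g_is_cokernel _ (K.homologyIsCokernel (n - 1) n hn)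
    obtain ⟨y, hy⟩ := (ShortComplex.moduleCat_exact_iff _).1 hex c hc
    refine ⟨y, ?_⟩
    rw [← show K.toCycles (n - 1) n y = c from hy]
    exact (ConcreteCategory.congr_hom (K.toCycles_i (n - 1) n) y).symm
  have nat (c : K.cycles n) : HomologicalComplex.homologyMap f n (K.homologyπ n c) =
      L.homologyπ n (HomologicalComplex.cyclesMap f n c) :=
    ConcreteCategory.congr_hom (HomologicalComplex.homologyπ_naturality f n) c
  have nat' (c : K.cycles n) : L.iCycles n (HomologicalComplex.cyclesMap f n c) =
      f.f n (K.iCycles n c) :=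
    ConcreteCategory.congr_hom (HomologicalComplex.cyclesMap_i f n) c
  rw [quasiIsoAt_iff_isIso_homologyMap, ConcreteCategory.isIso_iff_bijective]
  refine ⟨(injective_iff_map_eq_zero (HomologicalComplex.homologyMap f n).hom).2
      fun z hz ↦ ?_, fun z ↦ ?_⟩
  · obtain ⟨c, rfl⟩ := surj z
    replace hz := (nat c).symm.trans hz
    obtain ⟨y, hy⟩ := bd' _ hz
    obtain ⟨y', hy'⟩ := h₁ _ (dz c) y (hy.trans (nat' c))
    exact bd _ _ hy'
  · obtain ⟨c, rfl⟩ := surj z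
    obtain ⟨x, hx, y, hy⟩ := h₂ _ (dz c)
    have hex : (ShortComplex.mk (K.iCycles n) (K.d n (n + 1)) (K.iCycles_d n (n + 1))).Exact :=
      ShortComplex.exact_of_f_is_kernel _ (K.cyclesIsKernel n (n + 1) hn')
    obtain ⟨c', hc'⟩ := (ShortComplex.moduleCat_exact_iff _).1 hex x hx
    replace hc' : K.iCycles n c' = x := hc'
    refine ⟨K.homologyπ n c', ?_⟩
    rw [nat, ← sub_eq_zero, ← map_sub]
    refine bd _ y ?_
    rw [map_sub, nat', hc', hy]

end modules

/-! ### Cohomology of Hom complexes as homotopy classes -/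

section homComplex
open CochainComplex.HomComplex
variable {C : Type u} [Category.{v} C] [Preadditive C] {R : Type v} [Ring R]
  {D : CochainComplex C ℤ} (ρ : R →+* End D)

lemma CochainComplex.HomComplex.CohomologyClass.toHom_mk_precomp {K K' L : CochainComplex C ℤ}
    {n : ℤ} (z : Cocycle K L n) (g : K' ⟶ K) :
    CohomologyClass.toHom (.mk (z.precomp g)) =
      (HomotopyCategory.quotient _ _).map g ≫ CohomologyClass.toHom (.mk z) := by
  rw [CohomologyClass.toHom_mk, CohomologyClass.toHom_mk, Cocycle.equivHomShift_symm_precomp,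
    Functor.map_comp]

lemma CochainComplex.HomComplex.CohomologyClass.toHom_mk_postcomp {K L L' : CochainComplex C ℤ}
    {n : ℤ} (z : Cocycle K L n) (g : L ⟶ L') :
    CohomologyClass.toHom (.mk (z.postcomp g)) =
      CohomologyClass.toHom (.mk z) ≫ (HomotopyCategory.quotient _ _).map (g⟦n⟧') := by
  rw [CohomologyClass.toHom_mk, CohomologyClass.toHom_mk, Cocycle.equivHomShift_symm_postcomp,
    Functor.map_comp]

/-- Cocycles of degree n modulo coboundaries are the homotopy classes of maps M ⟶ D⟦n⟧. -/
lemma homComplex_exactAt_iff (M : CochainComplex C ℤ) (n : ℤ) :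
    (homComplex ρ M).ExactAt n ↔ ∀ f : (HomotopyCategory.quotient C (.up ℤ)).obj M ⟶
      (HomotopyCategory.quotient C (.up ℤ)).obj (D⟦n⟧), f = 0 := by
  rw [ModuleCat.exactAt_iff]
  refine ⟨fun h f ↦ ?_, fun h (z : Cochain M D n) (hz : δ n (n + 1) z = 0) ↦ ?_⟩
  · obtain ⟨z, rfl⟩ := (CohomologyClass.toHom_bijective M D n).2 f
    obtain ⟨z, rfl⟩ := z.mk_surjective
    rw [CohomologyClass.toHom_mk_eq_zero_iff, mem_coboundaries_iff _ (n - 1) (by lia)]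
    exact h (z : Cochain M D n) (z.δ_eq_zero (n + 1))
  · have := (CohomologyClass.toHom_mk_eq_zero_iff (Cocycle.mk z _ rfl hz)).1 (h _)
    rw [mem_coboundaries_iff _ (n - 1) (by lia)] at this
    exact this

lemma quasiIso_homComplexMap {M N : CochainComplex C ℤ} (q : M ⟶ N)
    (hq : ∀ n : ℤ, Function.Bijective fun f : (HomotopyCategory.quotient C (.up ℤ)).obj N ⟶
      (HomotopyCategory.quotient C (.up ℤ)).obj (D⟦n⟧) ↦ (HomotopyCategory.quotient C
          (.up ℤ)).map q ≫ f) :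
    QuasiIso (homComplexMap ρ q) where
  quasiIsoAt n := by
    refine ModuleCat.quasiIsoAt_of_forall _ n
      (fun (z : Cochain N D n) (hz : δ n (n + 1) z = 0) (y : Cochain M D (n - 1)) hy ↦ ?_)
      fun (z : Cochain M D n) (hz : δ n (n + 1) z = 0) ↦ ?_
    · have := (CohomologyClass.toHom_mk_eq_zero_iff ((Cocycle.mk z _ rfl hz).precomp q)).2
        ((mem_coboundaries_iff _ (n - 1) (by lia)).2 ⟨y, hy⟩)
      rw [CohomologyClass.toHom_mk_precomp] at this
      have := (CohomologyClass.toHom_mk_eq_zero_iff _).1 ((hq n).1 (this.trans comp_zero.symm))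
      rw [mem_coboundaries_iff _ (n - 1) (by lia)] at this
      exact this
    · obtain ⟨f, hf⟩ := (hq n).2 (CohomologyClass.toHom (.mk (Cocycle.mk z _ rfl hz)))
      obtain ⟨x, rfl⟩ := (CohomologyClass.toHom_bijective N D n).2 f
      obtain ⟨x, rfl⟩ := x.mk_surjective
      dsimp only at hf
      rw [← CohomologyClass.toHom_mk_precomp, ← sub_eq_zero, ← map_sub, ← CohomologyClass.mk_sub,
        CohomologyClass.toHom_mk_eq_zero_iff, mem_coboundaries_iff _ (n - 1) (by lia)] at hf
      exact ⟨(x : Cochain N D n), x.δ_eq_zero (n + 1), hf⟩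

end homComplex

/-! ### Postcomposition with a resolution that carries no action -/

section int
open CochainComplex.HomComplex
variable {C : Type u} [Category.{v} C] [Preadditive C]

lemma RingEquiv.smul_eq_zsmul {Z M : Type*} [Ring Z] (e : Z ≃+* ℤ) [AddCommGroup M] [Module Z M]
    (r : Z) (x : M) : r • x = e r • x := by
  obtain ⟨n, rfl⟩ := e.symm.surjective r
  rw [e.apply_symm_apply, ← Int.cast_smul_eq_zsmul Z n x]
  congr 1
  simp

/-- The action of the integers on a complex. -/
def intAction (J : CochainComplex C ℤ) : ULift.{v} ℤ →+* End J :=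
  (Int.castRingHom (End J)).comp ULift.ringEquiv.toRingHom

/-- An abelian group has only one module structure over the integers, so `cochainModule` need not be
unfolded. -/
lemma cochain_comp_intAction {M J : CochainComplex C ℤ} {n : ℤ} (z : Cochain M J n)
    (r : ULift.{v} ℤ) :
    z.comp (Cochain.ofHom (intAction J r)) (add_zero n) = r.down • z :=
  letI := cochainModule (intAction J) M n
  RingEquiv.smul_eq_zsmul ULift.ringEquiv r z

/-- The functor which forgets the module structures on a complex, but remembers the
additive groups. -/
noncomputable abbrev toIntComplex (R : Type v) [Ring R] :
    CochainComplex (ModuleCat.{v} R) ℤ ⥤ CochainComplex (ModuleCat.{v} (ULift.{v} ℤ)) ℤ :=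
  (ModuleCat.restrictScalars.{v} ((Int.castRingHom R).comp ULift.ringEquiv.toRingHom :
    ULift.{v} ℤ →+* R)).mapHomologicalComplex (.up ℤ)

variable {R : Type v} [Ring R] {D J : CochainComplex C ℤ} (ρ : R →+* End D) (j : D ⟶ J)

/-- Postcomposition of cochains with `j : D ⟶ J`. -/
noncomputable def homComplexPostcompVal (M : CochainComplex C ℤ) (n : ℤ) :
    ((toIntComplex R).obj (homComplex ρ M)).X n →+ Cochain M J n where
  toFun z := Cochain.comp (z : Cochain M D n) (Cochain.ofHom j) (add_zero n)
  map_zero' := Cochain.zero_comp _ _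
  map_add' _ _ := Cochain.add_comp _ _ _ _

/-- The morphism `Hom(M, D) ⟶ Hom(M, J)` of complexes of abelian groups induced by `D ⟶ J`. -/
noncomputable def homComplexPostcomp (M : CochainComplex C ℤ) :
    (toIntComplex R).obj (homComplex ρ M) ⟶ homComplex (intAction J) M :=
  homComplexLift _ (homComplexPostcompVal ρ j M)
    (fun n r z ↦ by
      rw [cochain_comp_intAction, RingEquiv.smul_eq_zsmul ULift.ringEquiv r z]
      exact map_zsmul (homComplexPostcompVal ρ j M n) r.down z)
    (fun n z ↦ (δ_comp_ofHom (z : Cochain M D n) j (n + 1)).symm)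

lemma homComplexPostcomp_naturality {M N : CochainComplex C ℤ} (f : M ⟶ N) :
    (toIntComplex R).map (homComplexMap ρ f) ≫ homComplexPostcomp ρ j M =
      homComplexPostcomp ρ j N ≫ homComplexMap (intAction J) f := by
  refine homVal_ext _ fun p (z : Cochain N D p) ↦ ?_
  exact Cochain.comp_assoc_of_third_is_zero_cochain (Cochain.ofHom f) z (Cochain.ofHom j)
    (zero_add p)

lemma quasiIso_homComplexPostcomp (M : CochainComplex C ℤ)
    (hj : ∀ n : ℤ, Function.Bijective fun f : (HomotopyCategory.quotient C (.up ℤ)).obj M ⟶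
      (HomotopyCategory.quotient C (.up ℤ)).obj (D⟦n⟧) ↦
        f ≫ (HomotopyCategory.quotient C (.up ℤ)).map (j⟦n⟧')) :
    QuasiIso (homComplexPostcomp ρ j M) where
  quasiIsoAt n := by
    refine ModuleCat.quasiIsoAt_of_forall _ n
      (fun (z : Cochain M D n) (hz : δ n (n + 1) z = 0) (y : Cochain M J (n - 1)) hy ↦ ?_)
      fun (z : Cochain M J n) (hz : δ n (n + 1) z = 0) ↦ ?_
    · have := (CohomologyClass.toHom_mk_eq_zero_iff ((Cocycle.mk z _ rfl hz).postcomp j)).2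
        ((mem_coboundaries_iff _ (n - 1) (by lia)).2 ⟨y, hy⟩)
      rw [CohomologyClass.toHom_mk_postcomp] at this
      have := (CohomologyClass.toHom_mk_eq_zero_iff _).1 ((hj n).1 (this.trans zero_comp.symm))
      rw [mem_coboundaries_iff _ (n - 1) (by lia)] at this
      exact this
    · obtain ⟨f, hf⟩ := (hj n).2 (CohomologyClass.toHom (.mk (Cocycle.mk z _ rfl hz)))
      obtain ⟨x, rfl⟩ := (CohomologyClass.toHom_bijective M D n).2 f
      obtain ⟨x, rfl⟩ := x.mk_surjective
      dsimp only at hf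
      rw [← CohomologyClass.toHom_mk_postcomp, ← sub_eq_zero, ← map_sub, ← CohomologyClass.mk_sub,
        CohomologyClass.toHom_mk_eq_zero_iff, mem_coboundaries_iff _ (n - 1) (by lia)] at hf
      exact ⟨(x : Cochain M D n), x.δ_eq_zero (n + 1), hf⟩

end int

/-! ### Hom complexes, short exact sequences and quasi-isomorphisms -/

section ses
open CochainComplex.HomComplex
variable {C : Type u} [Category.{v} C] [Abelian C] {R : Type v} [Ring R]
  {D : CochainComplex C ℤ} (ρ : R →+* End D)

lemma homComplexMap_id (M : CochainComplex C ℤ) : homComplexMap ρ (𝟙 M) = 𝟙 _ :=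
  (homComplexFunctor ρ).map_id (op M)

lemma homComplexMap_comp {M N P : CochainComplex C ℤ} (f : M ⟶ N) (g : N ⟶ P) :
    homComplexMap ρ (f ≫ g) = homComplexMap ρ g ≫ homComplexMap ρ f :=
  (homComplexFunctor ρ).map_comp g.op f.op

lemma homComplexMap_zero (M N : CochainComplex C ℤ) :
    homComplexMap ρ (0 : M ⟶ N) = 0 := by
  ext n z
  refine Eq.trans ?_ (Cochain.zero_comp (z : Cochain N D n) (zero_add n))
  exact congrArg (fun y ↦ Cochain.comp y (z : Cochain N D n) (zero_add n)) (Cochain.ofHom_zero M N)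

/-- The short complex `Hom(X₃, D) ⟶ Hom(X₂, D) ⟶ Hom(X₁, D)`. -/
@[simps]
def homShortComplex (S : ShortComplex (CochainComplex C ℤ)) :
    ShortComplex (CochainComplex (ModuleCat.{v} R) ℤ) where
  X₁ := homComplex ρ S.X₃
  X₂ := homComplex ρ S.X₂
  X₃ := homComplex ρ S.X₁
  f := homComplexMap ρ S.g
  g := homComplexMap ρ S.f
  zero := by rw [← homComplexMap_comp, S.zero, homComplexMap_zero]

/-- Left exactness of Hom gives all but surjectivity on the right, which is the extension property
`hD` applied degree by degree. That property holds if the terms of `S.X₃` are projective, or if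
those of `D` are injective. -/
lemma homShortComplex_shortExact {S : ShortComplex (CochainComplex C ℤ)} (hS : S.ShortExact)
    (hD : ∀ i j (g : S.X₁.X i ⟶ D.X j), ∃ k : S.X₂.X i ⟶ D.X j, S.f.f i ≫ k = g) :
    (homShortComplex ρ S).ShortExact := by
  refine HomologicalComplex.shortExact_of_degreewise_shortExact _ fun n ↦ ?_
  have hS' (p : ℤ) : (S.map (HomologicalComplex.eval _ _ p)).ShortExact :=
    (HomologicalComplex.shortExact_iff_degreewise_shortExact S).1 hS p
  have hg (p : ℤ) : Epi (S.map (HomologicalComplex.eval _ _ p)).g := (hS' p).epi_g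
  refine
    { exact := ?_
      mono_f := (ModuleCat.mono_iff_injective _).2 fun (z : Cochain S.X₃ D n)
          (z' : Cochain S.X₃ D n) h ↦ ?_
      epi_g := (ModuleCat.epi_iff_surjective _).2 fun (z : Cochain S.X₁ D n) ↦ ?_ }
  · refine (ShortComplex.moduleCat_exact_iff _).2 fun (z : Cochain S.X₂ D n)
      (hz : (Cochain.ofHom S.f).comp z (zero_add n) = 0) ↦ ?_
    have hz' (p q : ℤ) (hpq : p + n = q) : S.f.f p ≫ z.v p q hpq = 0 := by
      have := Cochain.congr_v hz p q hpq
      rwa [Cochain.zero_cochain_comp_v, Cochain.ofHom_v] at this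
    refine ⟨(Cochain.mk fun p q hpq ↦ (hS' p).exact.desc (z.v p q hpq) (hz' p q hpq) :
      Cochain S.X₃ D n), ?_⟩
    change (Cochain.ofHom S.g).comp _ (zero_add n) = z
    ext p q hpq
    rw [Cochain.zero_cochain_comp_v, Cochain.ofHom_v]
    exact (hS' p).exact.g_desc (z.v p q hpq) (hz' p q hpq)
  · replace h : (Cochain.ofHom S.g).comp z (zero_add n) =
      (Cochain.ofHom S.g).comp z' (zero_add n) := h
    refine Cochain.ext _ _ fun p q hpq ↦ ?_
    have := Cochain.congr_v h p q hpq
    rw [Cochain.zero_cochain_comp_v, Cochain.zero_cochain_comp_v, Cochain.ofHom_v] at this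
    exact (cancel_epi (S.map (HomologicalComplex.eval _ _ p)).g).1 this
  · refine ⟨(Cochain.mk fun p q hpq ↦ (hD p q (z.v p q hpq)).choose : Cochain S.X₂ D n), ?_⟩
    change (Cochain.ofHom S.f).comp _ (zero_add n) = z
    ext p q hpq
    rw [Cochain.zero_cochain_comp_v, Cochain.ofHom_v]
    exact (hD p q (z.v p q hpq)).choose_spec

lemma exists_extension_of_projective {S : ShortComplex (CochainComplex C ℤ)} (hS : S.ShortExact)
    [∀ i, Projective (S.X₃.X i)] (i : ℤ) {Y : C} (g : S.X₁.X i ⟶ Y) :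
    ∃ k : S.X₂.X i ⟶ Y, S.f.f i ≫ k = g := by
  have hS' := (HomologicalComplex.shortExact_iff_degreewise_shortExact S).1 hS i
  have : Projective ((S.map (HomologicalComplex.eval _ _ i)).X₃) :=
    inferInstanceAs (Projective (S.X₃.X i))
  have sp := hS'.splittingOfProjective
  let r : S.X₂.X i ⟶ S.X₁.X i := sp.r
  have hr : S.f.f i ≫ r = 𝟙 _ := sp.f_r
  exact ⟨r ≫ g, by rw [reassoc_of% hr]⟩

lemma exists_extension_of_injective {S : ShortComplex (CochainComplex C ℤ)} (hS : S.ShortExact)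
    (i : ℤ) {Y : C} [Injective Y] (g : S.X₁.X i ⟶ Y) :
    ∃ k : S.X₂.X i ⟶ Y, S.f.f i ≫ k = g := by
  have hS' := (HomologicalComplex.shortExact_iff_degreewise_shortExact S).1 hS i
  have : Mono (S.f.f i) := hS'.mono_f
  exact ⟨Injective.factorThru g (S.f.f i), Injective.comp_factorThru _ _⟩

section qh
variable [HasDerivedCategory.{w} C]

/-- Homotopy classes out of a K-projective complex are morphisms in the derived category, where `j`
is invertible. -/
lemma HomotopyCategory.comp_bijective_of_quasiIso_of_isKProjective {M : CochainComplex C ℤ}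
    [M.IsKProjective]
    {K L : CochainComplex C ℤ} (j : K ⟶ L) [QuasiIso j] :
    Function.Bijective fun f : (HomotopyCategory.quotient C (.up ℤ)).obj M ⟶
      (HomotopyCategory.quotient C (.up ℤ)).obj K ↦ f ≫ (HomotopyCategory.quotient C
          (.up ℤ)).map j := by
  have : IsIso (DerivedCategory.Qh.map ((HomotopyCategory.quotient C (.up ℤ)).map j)) := by
    rw [DerivedCategory.isIso_Qh_map_iff]
    rwa [HomotopyCategory.quotient_map_mem_quasiIso_iff, HomologicalComplex.mem_quasiIso_iff]
  rw [← Function.Bijective.of_comp_iff'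
    (CochainComplex.IsKProjective.Qh_map_bijective M ((HomotopyCategory.quotient C (.up ℤ)).obj L))]
  convert ((asIso (DerivedCategory.Qh.map
    ((HomotopyCategory.quotient C (.up ℤ)).map j))).homToEquiv.bijective).comp
    (CochainComplex.IsKProjective.Qh_map_bijective M ((HomotopyCategory.quotient C (.up ℤ)).obj K))
  ext f
  simp

lemma HomotopyCategory.comp_bijective_of_quasiIso_of_isKInjective {L : CochainComplex C ℤ}
    [L.IsKInjective]
    {M N : CochainComplex C ℤ} (q : M ⟶ N) [QuasiIso q] :
    Function.Bijective fun f : (HomotopyCategory.quotient C (.up ℤ)).obj N ⟶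
      (HomotopyCategory.quotient C (.up ℤ)).obj L ↦ (HomotopyCategory.quotient C
          (.up ℤ)).map q ≫ f := by
  have : IsIso (DerivedCategory.Qh.map ((HomotopyCategory.quotient C (.up ℤ)).map q)) := by
    rw [DerivedCategory.isIso_Qh_map_iff]
    rwa [HomotopyCategory.quotient_map_mem_quasiIso_iff, HomologicalComplex.mem_quasiIso_iff]
  rw [← Function.Bijective.of_comp_iff'
    (CochainComplex.IsKInjective.Qh_map_bijective ((HomotopyCategory.quotient C (.up ℤ)).obj M) L)]
  convert ((asIso (DerivedCategory.Qh.map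
    ((HomotopyCategory.quotient C (.up ℤ)).map q))).symm.homFromEquiv.bijective).comp
    (CochainComplex.IsKInjective.Qh_map_bijective ((HomotopyCategory.quotient C (.up ℤ)).obj N) L)
  ext f
  simp

end qh

attribute [local instance] HasDerivedCategory.standard

lemma quasiIso_homComplexMap_of_isKInjective [D.IsKInjective] {M N : CochainComplex C ℤ}
    (q : M ⟶ N) [QuasiIso q] : QuasiIso (homComplexMap ρ q) :=
  quasiIso_homComplexMap ρ q fun _ ↦
    HomotopyCategory.comp_bijective_of_quasiIso_of_isKInjective q

lemma quasiIso_homComplexPostcomp_of_isKProjective {J M : CochainComplex C ℤ} [M.IsKProjective]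
    (j : D ⟶ J) [QuasiIso j] : QuasiIso (homComplexPostcomp ρ j M) :=
  quasiIso_homComplexPostcomp ρ j M fun _ ↦
    HomotopyCategory.comp_bijective_of_quasiIso_of_isKProjective (j⟦_⟧')

end ses

/-! ### Two-out-of-three for quasi-isomorphisms between short exact sequences -/

section twoOutOfThree
variable {C : Type u} [Category.{v} C] [Abelian C]

attribute [local instance] HasDerivedCategory.standard

variable {S₁ S₂ : ShortComplex (CochainComplex C ℤ)} (h₁ : S₁.ShortExact) (h₂ : S₂.ShortExact)
  (f : S₁ ⟶ S₂)
include h₁ h₂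

lemma CochainComplex.quasiIso_τ₂ [hf₁ : QuasiIso f.τ₁] [hf₃ : QuasiIso f.τ₃] : QuasiIso f.τ₂ := by
  rw [← DerivedCategory.isIso_Q_map_iff_quasiIso] at hf₁ hf₃ ⊢
  exact Pretriangulated.isIso₂_of_isIso₁₃ (DerivedCategory.triangleOfSES.map h₁ h₂ f)
    (DerivedCategory.triangleOfSES_distinguished h₁)
    (DerivedCategory.triangleOfSES_distinguished h₂) hf₁ hf₃

lemma CochainComplex.quasiIso_τ₁ [hf₂ : QuasiIso f.τ₂] [hf₃ : QuasiIso f.τ₃] : QuasiIso f.τ₁ := by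
  rw [← DerivedCategory.isIso_Q_map_iff_quasiIso] at hf₂ hf₃ ⊢
  exact Pretriangulated.isIso₁_of_isIso₂₃ (DerivedCategory.triangleOfSES.map h₁ h₂ f)
    (DerivedCategory.triangleOfSES_distinguished h₁)
    (DerivedCategory.triangleOfSES_distinguished h₂) hf₂ hf₃

lemma CochainComplex.quasiIso_τ₃ [hf₁ : QuasiIso f.τ₁] [hf₂ : QuasiIso f.τ₂] : QuasiIso f.τ₃ := by
  rw [← DerivedCategory.isIso_Q_map_iff_quasiIso] at hf₁ hf₂ ⊢
  exact Pretriangulated.isIso₃_of_isIso₁₂ (DerivedCategory.triangleOfSES.map h₁ h₂ f)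
    (DerivedCategory.triangleOfSES_distinguished h₁)
    (DerivedCategory.triangleOfSES_distinguished h₂) hf₁ hf₂

end twoOutOfThree

/-! ### Transposition up to homotopy -/

section hot
variable {C : Type u} [Category.{v} C] [Preadditive C] {R : Type v} [Ring R]
  {D : CochainComplex C ℤ} (ρ : R →+* End D)

lemma homHotFunctor_map_quotient_map {M N : CochainComplex C ℤ} (f : M ⟶ N) :
    (homHotFunctor ρ).map ((HomotopyCategory.quotient C (.up ℤ)).map f).op =
      (HomotopyCategory.quotient _ _).map (homComplexMap ρ f) := rfl

/-- Both inclusions are sections of the projection π, and π ≫ ι₀ is homotopic to the identity of the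
cylinder; precompose with ι₁. -/
lemma CochainComplex.quotient_map_ι₀_eq_ι₁ [HasBinaryBiproducts C] (N : CochainComplex C ℤ) :
    (HomotopyCategory.quotient C (.up ℤ)).map (HomologicalComplex.cylinder.ι₀ N) =
      (HomotopyCategory.quotient C (.up ℤ)).map (HomologicalComplex.cylinder.ι₁ N) := by
  have := congrArg (fun k ↦ (HomotopyCategory.quotient C (.up ℤ)).map
    (HomologicalComplex.cylinder.ι₁ N) ≫ k) (HomotopyCategory.eq_of_homotopy _ _
    (HomologicalComplex.cylinder.πCompι₀Homotopy N fun j ↦ ⟨j - 1, by simp⟩))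
  simpa [← Functor.map_comp] using this

end hot

section hotTranspose
variable {R S T : Type u} [Ring R] [Ring S] [Ring T] {φ : R →+* T} {ψ : S →+* T}
  (h : ∀ a r, Commute (φ a) (ψ r)) (h' : ∀ r a, Commute (ψ r) (φ a))
  {D : CochainComplex (ModuleCat.{u} T) ℤ}

/-- A homotopy is a map out of the cylinder of N. By naturality its transpose, followed by the maps
that ι₀ and ι₁ induce on Hom(-, D), gives the two transposes; ι₀ and ι₁ agree up to homotopy, so no
transposed homotopy has to be written down. -/
lemma quotient_map_homTranspose_eq {M : CochainComplex (ModuleCat.{u} R) ℤ}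
    {N : CochainComplex (ModuleCat.{u} S) ℤ} {g g' : N ⟶ homComplex (actionHom φ ψ h D) M}
    (hg : (HomotopyCategory.quotient _ (.up ℤ)).map g =
      (HomotopyCategory.quotient _ (.up ℤ)).map g') :
    (HomotopyCategory.quotient _ (.up ℤ)).map (homTranspose h h' g) =
      (HomotopyCategory.quotient _ (.up ℤ)).map (homTranspose h h' g') := by
  let H := HomotopyCategory.homotopyOfEq _ _ hg
  rw [← HomologicalComplex.cylinder.ι₀_desc _ _ H, homTranspose_comp_left,
    Functor.map_comp, ← homHotFunctor_map_quotient_map, CochainComplex.quotient_map_ι₀_eq_ι₁,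
    homHotFunctor_map_quotient_map, ← Functor.map_comp, ← homTranspose_comp_left,
    HomologicalComplex.cylinder.ι₁_desc]

/-- The transposition on homotopy classes of morphisms. -/
noncomputable def hotTranspose {M : HomotopyCategory (ModuleCat.{u} R) (.up ℤ)}
    {N : HomotopyCategory (ModuleCat.{u} S) (.up ℤ)}
    (g : N ⟶ (homHotFunctor (actionHom φ ψ h D)).obj (op M)) :
    M ⟶ (homHotFunctor (actionHom ψ φ h' D)).obj (op N) :=
  (HomotopyCategory.quotient _ (.up ℤ)).map (X := M.as)
    (Y := homComplex (actionHom ψ φ h' D) N.as) (homTranspose h h'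
    ((HomotopyCategory.quotient _ (.up ℤ)).map_surjective (X := N.as)
      (Y := homComplex (actionHom φ ψ h D) M.as) g).choose)

lemma hotTranspose_quotient_map {M : CochainComplex (ModuleCat.{u} R) ℤ}
    {N : CochainComplex (ModuleCat.{u} S) ℤ} (g : N ⟶ homComplex (actionHom φ ψ h D) M) :
    hotTranspose h h' (M := (HomotopyCategory.quotient _ (.up ℤ)).obj M)
      (N := (HomotopyCategory.quotient _ (.up ℤ)).obj N)
      ((HomotopyCategory.quotient _ (.up ℤ)).map g) =
        (HomotopyCategory.quotient _ (.up ℤ)).map (homTranspose h h' g) :=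
  quotient_map_homTranspose_eq h h' ((HomotopyCategory.quotient _ (.up ℤ)).map_surjective (X := N)
      (Y := homComplex (actionHom φ ψ h D) M) _).choose_spec

lemma exists_hot_eq {M : HomotopyCategory (ModuleCat.{u} R) (.up ℤ)}
    {N : HomotopyCategory (ModuleCat.{u} S) (.up ℤ)}
    (g : N ⟶ (homHotFunctor (actionHom φ ψ h D)).obj (op M)) :
    ∃ g' : N.as ⟶ homComplex (actionHom φ ψ h D) M.as,
      (HomotopyCategory.quotient _ (.up ℤ)).map g' = g :=
  (HomotopyCategory.quotient _ (.up ℤ)).map_surjective (X := N.as)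
      (Y := homComplex (actionHom φ ψ h D) M.as) g

lemma hotTranspose_hotTranspose {M : HomotopyCategory (ModuleCat.{u} R) (.up ℤ)}
    {N : HomotopyCategory (ModuleCat.{u} S) (.up ℤ)}
    (g : N ⟶ (homHotFunctor (actionHom φ ψ h D)).obj (op M)) :
    hotTranspose h' h (hotTranspose h h' g) = g := by
  obtain ⟨g, rfl⟩ := exists_hot_eq h g
  refine (congrArg (hotTranspose h' h) (hotTranspose_quotient_map h h' g)).trans ?_
  refine (hotTranspose_quotient_map h' h _).trans ?_
  rw [homTranspose_homTranspose]

lemma hotTranspose_comp_left {M : HomotopyCategory (ModuleCat.{u} R) (.up ℤ)}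
    {N N' : HomotopyCategory (ModuleCat.{u} S) (.up ℤ)} (f : N' ⟶ N)
    (g : N ⟶ (homHotFunctor (actionHom φ ψ h D)).obj (op M)) :
    hotTranspose h h' (f ≫ g) =
      hotTranspose h h' g ≫ (homHotFunctor (actionHom ψ φ h' D)).map f.op := by
  obtain ⟨g, rfl⟩ := exists_hot_eq h g
  obtain ⟨f, rfl⟩ := (HomotopyCategory.quotient _ (.up ℤ)).map_surjective (X := N'.as) (Y := N.as) f
  refine (congrArg (hotTranspose h h') ((HomotopyCategory.quotient _
      (.up ℤ)).map_comp f g).symm).trans ?_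
  refine (hotTranspose_quotient_map h h' _).trans ?_
  rw [homTranspose_comp_left, Functor.map_comp, ← hotTranspose_quotient_map]
  rfl

lemma hotTranspose_comp_right {M M' : HomotopyCategory (ModuleCat.{u} R) (.up ℤ)}
    {N : HomotopyCategory (ModuleCat.{u} S) (.up ℤ)} (f : M' ⟶ M)
    (g : N ⟶ (homHotFunctor (actionHom φ ψ h D)).obj (op M)) :
    hotTranspose h h' (g ≫ (homHotFunctor (actionHom φ ψ h D)).map f.op) =
      f ≫ hotTranspose h h' g := by
  conv_lhs => rw [← hotTranspose_hotTranspose h h' (g := g), ← hotTranspose_comp_left h' h]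
  rw [hotTranspose_hotTranspose]

end hotTranspose

/-! ### Brutal truncations -/

section brutal
variable {R : Type u} [Ring R]

/-- The terms of a complex of modules are finitely generated projective modules. -/
def IsFinProj (K : CochainComplex (ModuleCat.{u} R) ℤ) : Prop :=
  ∀ i, Module.Finite R (K.X i) ∧ Module.Projective R (K.X i)

lemma IsFinProj.projective {K : CochainComplex (ModuleCat.{u} R) ℤ} (hK : IsFinProj K) (i : ℤ) :
    Projective (K.X i) :=
  have := (hK i).2
  inferInstance

variable (K : CochainComplex (ModuleCat.{u} R) ℤ) (N : ℤ)

open Classical in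
/-- The degree `i` term of the brutal truncation of a complex in degrees `≥ N`, as a submodule. -/
noncomputable def brutalSub (i : ℤ) : Submodule R (K.X i) := if N ≤ i then ⊤ else ⊥

lemma brutalSub_of_le {i : ℤ} (hi : N ≤ i) : brutalSub K N i = ⊤ := if_pos hi

lemma brutalSub_of_lt {i : ℤ} (hi : i < N) : brutalSub K N i = ⊥ := if_neg (by lia)

lemma brutalSub_le_comap (i j : ℤ) :
    brutalSub K N i ≤ (brutalSub K N j).comap (K.d i j).hom := by
  intro x hx
  by_cases hij : i + 1 = j
  · by_cases hi : N ≤ i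
    · rw [brutalSub_of_le K N (by lia : N ≤ j)]
      trivial
    · rw [brutalSub_of_lt K N (by lia : i < N)] at hx
      rw [(Submodule.mem_bot R).1 hx]
      exact zero_mem _
  · rw [K.shape i j hij]
    exact zero_mem (brutalSub K N j)

/-- The brutal truncation of a complex of modules in degrees `≥ N`. -/
noncomputable def brutalGE : CochainComplex (ModuleCat.{u} R) ℤ where
  X i := ModuleCat.of R (brutalSub K N i)
  d i j := ModuleCat.ofHom ((K.d i j).hom.restrict (brutalSub_le_comap K N i j))
  shape i j hij := by
    refine ModuleCat.hom_ext (LinearMap.ext fun (x : brutalSub K N i) ↦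
      Subtype.ext (p := (· ∈ brutalSub K N _)) ?_)
    exact (ConcreteCategory.congr_hom (K.shape i j hij) (x : K.X i))
  d_comp_d' i j k _ _ := by
    refine ModuleCat.hom_ext (LinearMap.ext fun (x : brutalSub K N i) ↦
      Subtype.ext (p := (· ∈ brutalSub K N _)) ?_)
    exact (ConcreteCategory.congr_hom (K.d_comp_d i j k) (x : K.X i))

/-- The brutal truncation of a complex of modules in degrees `< N`. -/
noncomputable def brutalLT : CochainComplex (ModuleCat.{u} R) ℤ where
  X i := ModuleCat.of R (K.X i ⧸ brutalSub K N i)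
  d i j := ModuleCat.ofHom (Submodule.mapQ _ _ (K.d i j).hom (brutalSub_le_comap K N i j))
  shape i j hij := by
    refine ModuleCat.hom_ext (Submodule.linearMap_qext _ (LinearMap.ext fun (x : K.X i) ↦ ?_))
    exact congrArg (Submodule.mkQ (brutalSub K N j))
      (ConcreteCategory.congr_hom (K.shape i j hij) (x : K.X i))
  d_comp_d' i j k _ _ := by
    refine ModuleCat.hom_ext (Submodule.linearMap_qext _ (LinearMap.ext fun (x : K.X i) ↦ ?_))
    exact congrArg (Submodule.mkQ (brutalSub K N k))
      (ConcreteCategory.congr_hom (K.d_comp_d i j k) (x : K.X i))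

/-- The short complex of brutal truncations. -/
noncomputable def brutalShortComplex : ShortComplex (CochainComplex (ModuleCat.{u} R) ℤ) where
  X₁ := brutalGE K N
  X₂ := K
  X₃ := brutalLT K N
  f := { f := fun i ↦ ModuleCat.ofHom (brutalSub K N i).subtype }
  g := { f := fun i ↦ ModuleCat.ofHom (brutalSub K N i).mkQ }
  zero := by
    ext i x
    exact (Submodule.Quotient.mk_eq_zero _).2 x.2

lemma brutalShortComplex_shortExact : (brutalShortComplex K N).ShortExact := by
  refine HomologicalComplex.shortExact_of_degreewise_shortExact _ fun i ↦
    { exact := (ShortComplex.moduleCat_exact_iff _).2 fun (x : K.X i) hx ↦ ?_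
      mono_f := (ModuleCat.mono_iff_injective _).2 Subtype.val_injective
      epi_g := (ModuleCat.epi_iff_surjective _).2 (Submodule.mkQ_surjective _) }
  exact ⟨⟨x, (Submodule.Quotient.mk_eq_zero _).1 hx⟩, rfl⟩

instance : (brutalGE K N).IsStrictlyGE N := by
  rw [CochainComplex.isStrictlyGE_iff]
  intro i hi
  have : Subsingleton (brutalSub K N i) := by
    rw [brutalSub_of_lt K N hi]
    infer_instance
  exact ModuleCat.isZero_of_subsingleton (ModuleCat.of R (brutalSub K N i))

instance : (brutalLT K N).IsStrictlyLE (N - 1) := by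
  rw [CochainComplex.isStrictlyLE_iff]
  intro i hi
  have : Subsingleton (K.X i ⧸ brutalSub K N i) := by
    rw [brutalSub_of_le K N (by lia)]
    infer_instance
  exact ModuleCat.isZero_of_subsingleton (ModuleCat.of R (K.X i ⧸ brutalSub K N i))

instance (d : ℤ) [K.IsStrictlyLE d] : (brutalGE K N).IsStrictlyLE d := by
  rw [CochainComplex.isStrictlyLE_iff]
  intro i hi
  have : Subsingleton (K.X i) := ModuleCat.subsingleton_of_isZero (K.isZero_of_isStrictlyLE d i hi)
  exact ModuleCat.isZero_of_subsingleton (ModuleCat.of R (brutalSub K N i))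

instance (c : ℤ) [K.IsStrictlyGE c] : (brutalLT K N).IsStrictlyGE c := by
  rw [CochainComplex.isStrictlyGE_iff]
  intro i hi
  have : Subsingleton (K.X i) := ModuleCat.subsingleton_of_isZero (K.isZero_of_isStrictlyGE c i hi)
  exact ModuleCat.isZero_of_subsingleton (ModuleCat.of R (K.X i ⧸ brutalSub K N i))

variable {K}

lemma IsFinProj.brutalGE (hK : IsFinProj K) : IsFinProj (brutalGE K N) := by
  intro i
  obtain ⟨_, _⟩ := hK i
  change Module.Finite R (brutalSub K N i) ∧ Module.Projective R (brutalSub K N i)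
  by_cases hi : N ≤ i
  · rw [brutalSub_of_le K N hi]
    exact ⟨.equiv Submodule.topEquiv.symm, .of_equiv Submodule.topEquiv.symm⟩
  · rw [brutalSub_of_lt K N (by lia)]
    exact ⟨inferInstance, inferInstance⟩

lemma IsFinProj.brutalLT (hK : IsFinProj K) : IsFinProj (brutalLT K N) := by
  intro i
  obtain ⟨_, _⟩ := hK i
  change Module.Finite R (K.X i ⧸ brutalSub K N i) ∧ Module.Projective R (K.X i ⧸ brutalSub K N i)
  refine ⟨inferInstance, ?_⟩
  by_cases hi : N ≤ i
  · rw [brutalSub_of_le K N hi]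
    infer_instance
  · rw [brutalSub_of_lt K N (by lia)]
    exact .of_equiv (Submodule.quotEquivOfEqBot ⊥ rfl).symm

end brutal

/-! ### Dévissage of perfect complexes -/

section devissage
variable {R : Type u} [Ring R]

/-- A class of complexes of modules which contains all perfect complexes. -/
structure ContainsPerfect (P : ObjectProperty (CochainComplex (ModuleCat.{u} R) ℤ)) : Prop where
  retract {X Y} (r : Retract X Y) : P Y → P X
  of_isZero {X} : IsZero ((HomotopyCategory.quotient _ (.up ℤ)).obj X) → P X
  ext₁ {S : ShortComplex (CochainComplex (ModuleCat.{u} R) ℤ)} (hS : S.ShortExact)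
    (hS' : ∀ i, Projective (S.X₃.X i)) : P S.X₂ → P S.X₃ → P S.X₁
  ext₂ {S : ShortComplex (CochainComplex (ModuleCat.{u} R) ℤ)} (hS : S.ShortExact)
    (hS' : ∀ i, Projective (S.X₃.X i)) : P S.X₁ → P S.X₃ → P S.X₂
  ext₃ {S : ShortComplex (CochainComplex (ModuleCat.{u} R) ℤ)} (hS : S.ShortExact)
    (hS' : ∀ i, Projective (S.X₃.X i)) : P S.X₁ → P S.X₂ → P S.X₃
  single : P ((HomologicalComplex.single _ (.up ℤ) 0).obj (ModuleCat.of R R))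

lemma CochainComplex.isZero_quotient_mappingCone_id {C : Type*} [Category* C] [Preadditive C]
    [HasZeroObject C] [HasBinaryBiproducts C] (K : CochainComplex C ℤ) :
    IsZero ((HomotopyCategory.quotient C (.up ℤ)).obj (CochainComplex.mappingCone (𝟙 K))) := by
  have h := HomotopyCategory.mappingCone_triangleh_distinguished (𝟙 K)
  refine (Pretriangulated.Triangle.isZero₃_iff_isIso₁ _ h).2 ?_
  exact inferInstanceAs (IsIso ((HomotopyCategory.quotient C (.up ℤ)).map (𝟙 K)))

instance (n : ℤ) (M : ModuleCat.{u} R) [Projective M] (i : ℤ) :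
    Projective (((HomologicalComplex.single (ModuleCat.{u} R) (.up ℤ) n).obj M).X i) := by
  by_cases h : i = n
  · subst h
    exact Projective.of_iso (HomologicalComplex.singleObjXSelf _ _ _).symm inferInstance
  · exact Projective.of_iso (HomologicalComplex.isZero_single_obj_X (.up ℤ) n M i h).isoZero.symm
      inferInstance

namespace ContainsPerfect
variable {P : ObjectProperty (CochainComplex (ModuleCat.{u} R) ℤ)} (hP : ContainsPerfect P)
include hP

lemma of_iso {X Y : CochainComplex (ModuleCat.{u} R) ℤ} (e : X ≅ Y) (h : P X) : P Y :=
  hP.retract { i := e.inv, r := e.hom } h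

/-- The sequence 0 → M → cone(𝟙 M) → M⟦1⟧ → 0 has a contractible middle term. -/
lemma shift_one_iff (M : CochainComplex (ModuleCat.{u} R) ℤ) [hM : ∀ i, Projective (M.X i)] :
    P (M⟦(1 : ℤ)⟧) ↔ P M := by
  have hS : (CochainComplex.mappingCone.triangleRotateShortComplex (𝟙 M)).ShortExact :=
    HomologicalComplex.shortExact_of_degreewise_shortExact _ fun i ↦
      (CochainComplex.mappingCone.triangleRotateShortComplexSplitting (𝟙 M) i).shortExact
  have hS' (i : ℤ) :
      Projective ((CochainComplex.mappingCone.triangleRotateShortComplex (𝟙 M)).X₃.X i) :=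
    hM (i + 1)
  have hcone := hP.of_isZero (CochainComplex.isZero_quotient_mappingCone_id M)
  exact ⟨fun h ↦ hP.ext₁ hS hS' hcone h, fun h ↦ hP.ext₃ hS hS' h hcone⟩

lemma shift_iff (M : CochainComplex (ModuleCat.{u} R) ℤ) [hM : ∀ i, Projective (M.X i)] (n : ℤ) :
    P (M⟦n⟧) ↔ P M := by
  have proj (n i : ℤ) : Projective ((M⟦n⟧).X i) := hM (i + n)
  have step (n : ℤ) : P (M⟦n + 1⟧) ↔ P (M⟦n⟧) := by
    rw [← hP.shift_one_iff (M⟦n⟧)]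
    have e : M⟦n + 1⟧ ≅ M⟦n⟧⟦(1 : ℤ)⟧ := (shiftFunctorAdd _ n 1).app M
    exact ⟨hP.of_iso e, hP.of_iso e.symm⟩
  induction n with
  | zero => exact ⟨hP.of_iso ((shiftFunctorZero _ ℤ).app M),
      hP.of_iso ((shiftFunctorZero _ ℤ).app M).symm⟩
  | succ n hn => exact (step n).trans hn
  | pred n hn =>
    have := step (-n - 1)
    rw [sub_add_cancel] at this
    exact this.symm.trans hn

lemma single_pi (n : ℕ) :
    P ((HomologicalComplex.single _ (.up ℤ) 0).obj (ModuleCat.of R (Fin n → R))) := by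
  induction n with
  | zero =>
    refine hP.of_isZero (Functor.map_isZero _ (Functor.map_isZero _ ?_))
    exact ModuleCat.isZero_of_subsingleton _
  | succ n hn =>
    -- The sequence 0 → R → R^(n+1) → R^n → 0: inclusion of the coordinate 0, then the map that
    -- forgets it.
    let S : ShortComplex (ModuleCat.{u} R) := ShortComplex.mk
      (ModuleCat.ofHom (LinearMap.single R (fun _ : Fin (n + 1) ↦ R) 0))
      (ModuleCat.ofHom (LinearMap.funLeft R R (Fin.succ : Fin n → Fin (n + 1)))) (by
        refine ModuleCat.hom_ext (LinearMap.ext fun (x : R) ↦ funext fun i ↦ ?_)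
        exact Pi.single_eq_of_ne (M := fun _ : Fin (n + 1) ↦ R) (Fin.succ_ne_zero i) x)
    have hS : S.ShortExact :=
      { exact := (ShortComplex.moduleCat_exact_iff _).2 fun (x : Fin (n + 1) → R) hx ↦ by
          refine ⟨x 0, funext fun i ↦ ?_⟩
          obtain rfl | ⟨i, rfl⟩ := i.eq_zero_or_eq_succ
          · exact Pi.single_eq_same (M := fun _ : Fin (n + 1) ↦ R) 0 (x 0)
          · exact (Pi.single_eq_of_ne (M := fun _ : Fin (n + 1) ↦ R) (Fin.succ_ne_zero i)
              (x 0)).trans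
              (congrFun hx i).symm
        mono_f := (ModuleCat.mono_iff_injective _).2 (Pi.single_injective (M :=
            fun _ : Fin (n + 1) ↦ R) 0)
        epi_g := (ModuleCat.epi_iff_surjective _).2
          (LinearMap.funLeft_surjective_of_injective R R _ (Fin.succ_injective n)) }
    have := hS.map_of_exact (HomologicalComplex.single (ModuleCat.{u} R) (.up ℤ) 0)
    exact hP.ext₂ this (fun i ↦ inferInstanceAs (Projective
      (((HomologicalComplex.single (ModuleCat.{u} R) (.up ℤ) 0).obj
        (ModuleCat.of R (Fin n → R))).X i))) hP.single hn

/-- In degree 0 the module is a retract of some R^k; shifting by n reaches the other degrees. -/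
lemma single_of_finite_projective (M : ModuleCat.{u} R) [Module.Finite R M] [Module.Projective R M]
    (n : ℤ) : P ((HomologicalComplex.single _ (.up ℤ) n).obj M) := by
  obtain ⟨k, f, hf⟩ := Module.Finite.exists_fin' R M
  obtain ⟨g, hg⟩ := Module.projective_lifting_property f LinearMap.id hf
  let r : Retract M (ModuleCat.of R (Fin k → R)) :=
    { i := ModuleCat.ofHom g, r := ModuleCat.ofHom f, retract := ModuleCat.hom_ext hg }
  have h₀ := hP.retract (r.map (HomologicalComplex.single _ (.up ℤ) 0)) (hP.single_pi k)
  have e := ((CochainComplex.singleFunctors (ModuleCat.{u} R)).shiftIso n 0 n (by lia)).app M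
  exact (hP.shift_iff ((HomologicalComplex.single _ (.up ℤ) n).obj M) n).1 (hP.of_iso e.symm h₀)

/-- Induction on the length of [c, d]: the truncation in degrees ≥ d is a single projective module,
and the one in degrees < d is shorter. -/
lemma of_bounded (K : CochainComplex (ModuleCat.{u} R) ℤ) (hK : IsFinProj K) (c d : ℤ)
    [K.IsStrictlyGE c] [K.IsStrictlyLE d] : P K := by
  obtain ⟨n, hn⟩ : ∃ n : ℕ, d - c < n := ⟨(d - c + 1).toNat, by lia⟩
  induction n generalizing K d with
  | zero =>
    refine hP.of_isZero (Functor.map_isZero _ ?_)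
    rw [IsZero.iff_id_eq_zero]
    ext1 i
    by_cases hi : i < c
    · exact (K.isZero_of_isStrictlyGE c i hi).eq_of_src _ _
    · exact (K.isZero_of_isStrictlyLE d i (by lia)).eq_of_src _ _
  | succ n hn' =>
    refine hP.ext₂ (brutalShortComplex_shortExact K d) (hK.brutalLT d).projective ?_
      (hn' (brutalLT K d) (hK.brutalLT d) (d - 1) (by lia))
    change P (brutalGE K d)
    obtain ⟨M, ⟨e⟩⟩ := (brutalGE K d).exists_iso_single d
    have e' : (brutalGE K d).X d ≅ M := (HomologicalComplex.eval _ (.up ℤ) d).mapIso e ≪≫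
      HomologicalComplex.singleObjXSelf (.up ℤ) _ _
    obtain ⟨_, _⟩ := hK.brutalGE d d
    have : Module.Finite R M := .equiv e'.toLinearEquiv
    have : Module.Projective R M := .of_equiv e'.toLinearEquiv
    exact hP.of_iso e.symm (hP.single_of_finite_projective M d)

end ContainsPerfect

end devissage

/-! ### Exactness of restriction of scalars -/

section restrictScalars
variable {R S : Type u} [Ring R] [Ring S] (f : R →+* S)

lemma ModuleCat.exact_map_restrictScalars (X : ShortComplex (ModuleCat.{u} S)) (hX : X.Exact) :
    (X.map (ModuleCat.restrictScalars.{u} f)).Exact := by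
  rw [ShortComplex.ShortExact.moduleCat_exact_iff_function_exact] at hX ⊢
  exact hX

instance preservesFiniteLimits_restrictScalars :
    PreservesFiniteLimits (ModuleCat.restrictScalars.{u} f) := by
  have := ((Functor.exact_tfae (ModuleCat.restrictScalars.{u} f)).out 1 3).1
    (ModuleCat.exact_map_restrictScalars f)
  exact this.1

instance preservesFiniteColimits_restrictScalars :
    PreservesFiniteColimits (ModuleCat.restrictScalars.{u} f) := by
  have := ((Functor.exact_tfae (ModuleCat.restrictScalars.{u} f)).out 1 3).1
    (ModuleCat.exact_map_restrictScalars f)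
  exact this.2

end restrictScalars

/-! ### Contractible and acyclic complexes -/

section zero
variable {C : Type u} [Category.{v} C] [Abelian C]

attribute [local instance] HasDerivedCategory.standard in
lemma CochainComplex.acyclic_of_isZero_quotient {K : CochainComplex C ℤ}
    (hK : IsZero ((HomotopyCategory.quotient C (.up ℤ)).obj K)) : K.Acyclic := by
  rw [← HomotopyCategory.quotient_obj_mem_subcategoryAcyclic_iff_acyclic]
  exact ObjectProperty.prop_of_isZero _ hK

lemma CochainComplex.quasiIso_of_acyclic {K L : CochainComplex C ℤ} (f : K ⟶ L)
    (hK : K.Acyclic) (hL : L.Acyclic) : QuasiIso f where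
  quasiIsoAt n := (quasiIsoAt_iff_exactAt f n (hK n)).2 (hL n)

lemma isZero_quotient_homComplex {R : Type v} [Ring R] {D : CochainComplex C ℤ} (ρ : R →+* End D)
    {K : CochainComplex C ℤ} (hK : IsZero ((HomotopyCategory.quotient C (.up ℤ)).obj K)) :
    IsZero ((HomotopyCategory.quotient _ (.up ℤ)).obj (homComplex ρ K)) := by
  rw [IsZero.iff_id_eq_zero] at hK ⊢
  rw [← CategoryTheory.Functor.map_id, ← homComplexMap_id, ← homHotFunctor_map_quotient_map,
      CategoryTheory.Functor.map_id, hK,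
    ← (HomotopyCategory.quotient C (.up ℤ)).map_zero, homHotFunctor_map_quotient_map,
    homComplexMap_zero, Functor.map_zero]

end zero

/-! ### The biduality morphism -/

section biduality
variable {R S T : Type u} [Ring R] [Ring S] [Ring T] {φ : R →+* T} {ψ : S →+* T}
  (h : ∀ a r, Commute (φ a) (ψ r)) (h' : ∀ r a, Commute (ψ r) (φ a))
  {D : CochainComplex (ModuleCat.{u} T) ℤ} {J : CochainComplex (ModuleCat.{u} S) ℤ}
  (j : resComplex ψ D ⟶ J)

lemma quasiIso_toIntComplex_map_iff {K L : CochainComplex (ModuleCat.{u} R) ℤ} (f : K ⟶ L) :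
    QuasiIso ((toIntComplex R).map f) ↔ QuasiIso f :=
  HomologicalComplex.quasiIso_map_iff_of_preservesHomology _ _

/-- The biduality morphism `M ⟶ Hom(Hom(M, D), J)`. -/
noncomputable def biduality (M : CochainComplex (ModuleCat.{u} R) ℤ) :
    (toIntComplex R).obj M ⟶ homComplex (intAction J) (homComplex (actionHom φ ψ h D) M) :=
  (toIntComplex R).map (homTranspose h h' (𝟙 (homComplex (actionHom φ ψ h D) M))) ≫
    homComplexPostcomp (actionHom ψ φ h' D) j _

lemma biduality_naturality {M M' : CochainComplex (ModuleCat.{u} R) ℤ} (f : M' ⟶ M) :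
    (toIntComplex R).map f ≫ biduality h h' j M =
      biduality h h' j M' ≫ homComplexMap (intAction J) (homComplexMap (actionHom φ ψ h D) f) := by
  dsimp only [biduality]
  rw [Category.assoc, ← homComplexPostcomp_naturality, ← Functor.map_comp_assoc,
    ← Functor.map_comp_assoc, ← homTranspose_comp_right, ← homTranspose_comp_left,
    Category.id_comp, Category.comp_id]

/-- Every transpose factors through the universal one, that of the identity of Hom(M, D), and the
latter followed by `j` is `biduality`. -/
lemma toIntComplex_map_homTranspose_comp {M : CochainComplex (ModuleCat.{u} R) ℤ}
    {N : CochainComplex (ModuleCat.{u} S) ℤ} (q : N ⟶ homComplex (actionHom φ ψ h D) M) :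
    (toIntComplex R).map (homTranspose h h' q) ≫ homComplexPostcomp (actionHom ψ φ h' D) j N =
      biduality h h' j M ≫ homComplexMap (intAction J) q := by
  dsimp only [biduality]
  rw [Category.assoc, ← homComplexPostcomp_naturality, ← Functor.map_comp_assoc,
    ← homTranspose_comp_left, Category.comp_id]

/-- In the square of `toIntComplex_map_homTranspose_comp`, Hom(N, D) → Hom(N, J) is a
quasi-isomorphism because N is K-projective, and Hom(q, J) is one because J is K-injective. -/
lemma quasiIso_homTranspose_iff [J.IsKInjective] [QuasiIso j]
    {M : CochainComplex (ModuleCat.{u} R) ℤ}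
    {N : CochainComplex (ModuleCat.{u} S) ℤ} [N.IsKProjective]
    (q : N ⟶ homComplex (actionHom φ ψ h D) M) [QuasiIso q] :
    QuasiIso (homTranspose h h' q) ↔ QuasiIso (biduality h h' j M) := by
  have := quasiIso_homComplexPostcomp_of_isKProjective (actionHom ψ φ h' D) (M := N) j
  have := quasiIso_homComplexMap_of_isKInjective (intAction J) q
  rw [← quasiIso_toIntComplex_map_iff,
    ← quasiIso_iff_comp_right _ (homComplexPostcomp (actionHom ψ φ h' D) j N),
    toIntComplex_map_homTranspose_comp, quasiIso_iff_comp_right]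

/-- The short complex obtained by forgetting the module structures. -/
@[simps]
noncomputable def intShortComplex (X : ShortComplex (CochainComplex (ModuleCat.{u} R) ℤ)) :
    ShortComplex (CochainComplex (ModuleCat.{u} (ULift.{u} ℤ)) ℤ) where
  X₁ := (toIntComplex R).obj X.X₁
  X₂ := (toIntComplex R).obj X.X₂
  X₃ := (toIntComplex R).obj X.X₃
  f := (toIntComplex R).map X.f
  g := (toIntComplex R).map X.g
  zero := by rw [← Functor.map_comp, X.zero, Functor.map_zero]

/-- The morphism of short complexes given by the biduality morphisms. -/
noncomputable def bidualityShortComplex (X : ShortComplex (CochainComplex (ModuleCat.{u} R) ℤ)) :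
    intShortComplex X ⟶
      homShortComplex (intAction J) (homShortComplex (actionHom φ ψ h D) X) :=
  ShortComplex.homMk (S₁ := intShortComplex X)
    (S₂ := homShortComplex (intAction J) (homShortComplex (actionHom φ ψ h D) X))
    (biduality h h' j X.X₁) (biduality h h' j X.X₂) (biduality h h' j X.X₃)
    (biduality_naturality h h' j X.f).symm (biduality_naturality h h' j X.g).symm

lemma shortExact_intShortComplex {X : ShortComplex (CochainComplex (ModuleCat.{u} R) ℤ)}
    (hX : X.ShortExact) : (intShortComplex X).ShortExact := by
  refine HomologicalComplex.shortExact_of_degreewise_shortExact _ fun i ↦ ?_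
  have h := (HomologicalComplex.shortExact_iff_degreewise_shortExact X).1 hX i
  have h₁ := (ShortComplex.moduleCat_exact_iff _).1 h.exact
  have h₂ := (ModuleCat.mono_iff_injective _).1 h.mono_f
  have h₃ := (ModuleCat.epi_iff_surjective _).1 h.epi_g
  exact
    { exact := (ShortComplex.moduleCat_exact_iff _).2 h₁
      mono_f := (ModuleCat.mono_iff_injective _).2 h₂
      epi_g := (ModuleCat.epi_iff_surjective _).2 h₃ }

/-- The inner dual is exact because the sequence splits in each degree, the outer one because J has
injective terms. -/
lemma shortExact_homShortComplex_homShortComplex [∀ i, Injective (J.X i)]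
    {X : ShortComplex (CochainComplex (ModuleCat.{u} R) ℤ)}
    (hX : X.ShortExact) (hX' : ∀ i, Projective (X.X₃.X i)) :
    (homShortComplex (intAction J) (homShortComplex (actionHom φ ψ h D) X)).ShortExact := by
  refine homShortComplex_shortExact _ (homShortComplex_shortExact _ hX
    fun i _ ↦ exists_extension_of_projective hX i) fun i _ ↦ exists_extension_of_injective ?_ i
  exact homShortComplex_shortExact _ hX fun i _ ↦ exists_extension_of_projective hX i

end biduality

/-! ### Hom complexes and morphisms in the derived category -/

section kInjective
open CochainComplex.HomComplex
variable {C : Type u} [Category.{v} C] [Abelian C]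

lemma CochainComplex.HomComplex.exists_δ_eq_iff {K L : CochainComplex C ℤ} (f g : K ⟶ L) :
    (∃ z, δ (-1) 0 z = Cochain.ofHom f - Cochain.ofHom g) ↔
      (HomotopyCategory.quotient C (.up ℤ)).map f = (HomotopyCategory.quotient C
          (.up ℤ)).map g := by
  refine ⟨fun ⟨z, hz⟩ ↦ HomotopyCategory.eq_of_homotopy _ _ ((Cochain.equivHomotopy f g).symm
    ⟨z, by rw [hz, sub_add_cancel]⟩), fun h ↦ ?_⟩
  have z := Cochain.equivHomotopy f g (HomotopyCategory.homotopyOfEq _ _ h)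
  exact ⟨z.1, eq_sub_of_add_eq z.2.symm⟩

variable [HasDerivedCategory.{w} C]

lemma CochainComplex.Qh_map_eq_conj {K L : CochainComplex C ℤ} (f : K ⟶ L) :
    DerivedCategory.Qh.map ((HomotopyCategory.quotient C (.up ℤ)).map f) =
      (DerivedCategory.quotientCompQhIso C).hom.app K ≫ DerivedCategory.Q.map f ≫
        (DerivedCategory.quotientCompQhIso C).inv.app L := by
  rw [← DerivedCategory.quotientCompQhIso_hom_naturality_assoc, Iso.hom_inv_id_app]
  exact (Category.comp_id _).symm

lemma CochainComplex.Q_map_eq_iff (K L : CochainComplex C ℤ)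
    (hKL : Function.Bijective (DerivedCategory.Qh.map : ((HomotopyCategory.quotient C
        (.up ℤ)).obj K ⟶
      (HomotopyCategory.quotient C (.up ℤ)).obj L) → _)) (f g : K ⟶ L) :
    DerivedCategory.Q.map f = DerivedCategory.Q.map g ↔
      (HomotopyCategory.quotient C (.up ℤ)).map f = (HomotopyCategory.quotient C
          (.up ℤ)).map g := by
  rw [← hKL.1.eq_iff, Qh_map_eq_conj, Qh_map_eq_conj, cancel_epi, cancel_mono]

lemma CochainComplex.exists_Q_map_eq (K L : CochainComplex C ℤ)
    (hKL : Function.Bijective (DerivedCategory.Qh.map : ((HomotopyCategory.quotient C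
        (.up ℤ)).obj K ⟶
      (HomotopyCategory.quotient C (.up ℤ)).obj L) → _))
    (f : DerivedCategory.Q.obj K ⟶ DerivedCategory.Q.obj L) : ∃ g, DerivedCategory.Q.map g = f := by
  obtain ⟨g, hg⟩ := hKL.2 ((DerivedCategory.quotientCompQhIso C).hom.app K ≫ f ≫
    (DerivedCategory.quotientCompQhIso C).inv.app L)
  obtain ⟨g, rfl⟩ := (HomotopyCategory.quotient C (.up ℤ)).map_surjective g
  refine ⟨g, ?_⟩
  rwa [Qh_map_eq_conj, cancel_epi, cancel_mono] at hg

/-- The hypothesis `hMD` covers both situations in which Hom(M, D) is already derived: M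
K-projective, or D⟦n⟧ K-injective. -/
lemma homComplex_exactAt_iff_Q {R : Type v} [Ring R] {D : CochainComplex C ℤ} (ρ : R →+* End D)
    (M : CochainComplex C ℤ) (n : ℤ)
    (hMD : Function.Bijective (DerivedCategory.Qh.map : ((HomotopyCategory.quotient C
        (.up ℤ)).obj M ⟶
      (HomotopyCategory.quotient C (.up ℤ)).obj (D⟦n⟧)) → _)) :
    (homComplex ρ M).ExactAt n ↔
      ∀ f : DerivedCategory.Q.obj M ⟶ (DerivedCategory.Q.obj D)⟦n⟧, f = 0 := by
  rw [homComplex_exactAt_iff]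
  refine ⟨fun h f ↦ ?_, fun h f ↦ ?_⟩
  · obtain ⟨g, hg⟩ := CochainComplex.exists_Q_map_eq M (D⟦n⟧) hMD
      (f ≫ (DerivedCategory.Q.commShiftIso n).inv.app D)
    rw [← cancel_mono ((DerivedCategory.Q.commShiftIso n).inv.app D), ← hg, zero_comp,
      ← DerivedCategory.Q.map_zero, CochainComplex.Q_map_eq_iff M _ hMD, Functor.map_zero]
    exact h _
  · obtain ⟨f, rfl⟩ := (HomotopyCategory.quotient C (.up ℤ)).map_surjective f
    rw [← (HomotopyCategory.quotient C (.up ℤ)).map_zero, ← CochainComplex.Q_map_eq_iff M _ hMD,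
        Functor.map_zero,
      ← cancel_mono ((DerivedCategory.Q.commShiftIso n).hom.app D), zero_comp]
    exact h _

end kInjective

/-! ### Biduality of the ring itself and the homothety map -/

section homothety
open CochainComplex.HomComplex
variable {R S T : Type u} [Ring R] [Ring S] [Ring T] {φ : R →+* T} {ψ : S →+* T}
  (h : ∀ a r, Commute (φ a) (ψ r)) (h' : ∀ r a, Commute (ψ r) (φ a))
  {D : CochainComplex (ModuleCat.{u} T) ℤ} {J : CochainComplex (ModuleCat.{u} S) ℤ}
  (j : resComplex ψ D ⟶ J)

/-- The module `R` over a ring `R`, as a complex in degree zero. -/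
noncomputable abbrev singleRing (R : Type u) [Ring R] : CochainComplex (ModuleCat.{u} R) ℤ :=
  (HomologicalComplex.single _ (.up ℤ) 0).obj (ModuleCat.of R R)

/-- The element `r` of the degree zero part of `R` as a complex. -/
noncomputable def singleRingMk (r : R) : (singleRing R).X 0 :=
  (HomologicalComplex.singleObjXSelf (.up ℤ) 0 (ModuleCat.of R R)).inv r

lemma singleRing_X_surjective (x : (singleRing R).X 0) : ∃ r : R, x = singleRingMk r :=
  ⟨(HomologicalComplex.singleObjXSelf (.up ℤ) 0 (ModuleCat.of R R)).hom x,
    (ConcreteCategory.congr_hom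
      (HomologicalComplex.singleObjXSelf (.up ℤ) 0 (ModuleCat.of R R)).hom_inv_id x).symm⟩

lemma singleRingMk_eq_smul (r : R) : singleRingMk r = r • singleRingMk (1 : R) := by
  conv_lhs => rw [← mul_one r]
  exact map_smul (HomologicalComplex.singleObjXSelf (.up ℤ) 0 (ModuleCat.of R R)).inv.hom r (1 : R)

lemma singleRing_X_eq_zero {i : ℤ} (hi : i ≠ 0) (x : (singleRing R).X i) : x = 0 :=
  have := ModuleCat.subsingleton_of_isZero
    (HomologicalComplex.isZero_single_obj_X (.up ℤ) 0 (ModuleCat.of R R) i hi)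
  Subsingleton.elim _ _

/-- The homothety morphism `R ⟶ Hom(D, D)`. -/
noncomputable def homothety : singleRing R ⟶ homComplex (actionHom ψ φ h' D) (resComplex ψ D) :=
  letI := cochainModule (actionHom ψ φ h' D) (resComplex ψ D) 0
  HomologicalComplex.mkHomFromSingle
    (ModuleCat.ofHom (X := R) (Y := Cochain (resComplex ψ D) (resComplex ψ D) 0)
      (LinearMap.toSpanSingleton R _ (Cochain.ofHom (𝟙 _)))) (fun k _ ↦ by
        refine ModuleCat.hom_ext (LinearMap.ext_ring ?_)
        change δ 0 k ((1 : R) • Cochain.ofHom (𝟙 (resComplex ψ D))) = 0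
        rw [one_smul, δ_ofHom])

lemma homVal_homothety (r : R) :
    homVal _ (homothety h' (D := D)) 0 (singleRingMk r) = Cochain.ofHom (actionHom ψ φ h' D r) := by
  let := cochainModule (actionHom ψ φ h' D) (resComplex ψ D) 0
  have e : (homothety h' (D := D)).f 0 = _ := HomologicalComplex.mkHomFromSingle_f _ _
  have : homVal _ (homothety h' (D := D)) 0 (singleRingMk r) =
      r • Cochain.ofHom (𝟙 (resComplex ψ D)) := by
    change (homothety h' (D := D)).f 0 (singleRingMk r) = _
    rw [e]
    change (LinearMap.toSpanSingleton R (Cochain (resComplex ψ D) (resComplex ψ D) 0)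
      (Cochain.ofHom (𝟙 _))) ((HomologicalComplex.singleObjXSelf (.up ℤ) 0 (ModuleCat.of R R)).hom
        ((HomologicalComplex.singleObjXSelf (.up ℤ) 0 (ModuleCat.of R R)).inv r)) = _
    exact congrArg (LinearMap.toSpanSingleton R (Cochain (resComplex ψ D) (resComplex ψ D) 0)
      (Cochain.ofHom (𝟙 _))) (ConcreteCategory.congr_hom
        (HomologicalComplex.singleObjXSelf (.up ℤ) 0 (ModuleCat.of R R)).inv_hom_id r)
  rw [this]
  exact Cochain.id_comp (n := 0) _

/-- The morphism `D ⟶ Hom(R, D)` (an isomorphism). -/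
noncomputable def toHomSingleRing : resComplex ψ D ⟶ homComplex (actionHom φ ψ h D)
    (singleRing R) :=
  homTranspose h' h (homothety h')

lemma cochainEval_toHomSingleRing (p : ℤ) (x : (resComplex ψ D).X p) :
    cochainEval 0 p (zero_add p) (homVal _ (toHomSingleRing h h') p x) (singleRingMk (1 : R)) =
      (x : D.X p) := by
  change cochainEval 0 p _ (homVal _ (homTranspose h' h (homothety h')) p x) _ = _
  rw [cochainEval_homTranspose h' h, homVal_homothety, map_one, mul_zero, Int.negOnePow_zero,
    one_smul]
  change ((Cochain.ofHom (𝟙 (resComplex ψ D))).v p p (add_zero p)) x = _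
  rw [Cochain.ofHom_v]
  rfl

lemma cochain_singleRing_ext {n : ℤ} {z z' : Cochain (singleRing R) (resComplex φ D) n}
    (hz : cochainEval 0 n (zero_add n) z (singleRingMk 1) =
      cochainEval 0 n (zero_add n) z' (singleRingMk 1)) : z = z' := by
  refine cochainEval_ext fun p q hpq x ↦ ?_
  by_cases hp : p = 0
  · subst hp
    obtain rfl : n = q := by lia
    obtain ⟨r, hr⟩ := singleRing_X_surjective (R := R) x
    rw [hr, singleRingMk_eq_smul, cochainEval_smul_right, cochainEval_smul_right, hz]
  · rw [singleRing_X_eq_zero hp x, map_zero, map_zero]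

/-- A cochain out of R is freely determined by its value at 1, and x is sent to the cochain whose
value there is x. -/
instance : IsIso (toHomSingleRing h h' (D := D)) := by
  have (p : ℤ) : IsIso ((toHomSingleRing h h' (D := D)).f p) := by
    rw [ConcreteCategory.isIso_iff_bijective]
    refine ⟨fun x y hxy ↦ ?_, fun (z : Cochain (singleRing R) (resComplex φ D) p) ↦
      ⟨(cochainEval 0 p (zero_add p) z (singleRingMk 1) : D.X p), ?_⟩⟩
    · rw [← cochainEval_toHomSingleRing h h' p x, ← cochainEval_toHomSingleRing h h' p y]
      exact congrArg (fun z : Cochain (singleRing R) (resComplex φ D) p ↦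
        cochainEval 0 p (zero_add p) z (singleRingMk (1 : R))) hxy
    · exact cochain_singleRing_ext (cochainEval_toHomSingleRing h h' p _)
  exact HomologicalComplex.Hom.isIso_of_components _

/-- The isomorphism D ≅ Hom(R, D) is the transpose of the homothety, so transposing it back returns
the homothety. Hence the two maps differ by the isomorphism Hom(Hom(R, D), J) ≅ Hom(D, J). -/
lemma quasiIso_biduality_singleRing_iff [QuasiIso j] [J.IsKInjective] :
    QuasiIso (biduality h h' j (singleRing R)) ↔
      QuasiIso ((toIntComplex R).map (homothety h') ≫ homComplexPostcomp
          (actionHom ψ φ h' D) j _) := by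
  have e := toIntComplex_map_homTranspose_comp h h' j (toHomSingleRing h h')
  rw [show homTranspose h h' (toHomSingleRing h h') = homothety h' (D := D) from
    homTranspose_homTranspose _ _ _] at e
  have := quasiIso_homComplexMap_of_isKInjective (intAction J) (toHomSingleRing h h' (D := D))
  rw [e, quasiIso_iff_comp_right]

variable [HasDerivedCategory.{w} (ModuleCat.{u} S)]

-- As J is K-injective and `j` is invertible in the derived category, H^n Hom(D, J) is the group of
-- derived morphisms D ⟶ D⟦n⟧. By `hD` this is R for n = 0 and zero otherwise, like the cohomology
-- of `singleRing R`.
variable {h'} in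
lemma quasiIso_biduality_singleRing [QuasiIso j] [J.IsKInjective]
    (hD : IsHomothetyIso (actionHom ψ φ h' D)) : QuasiIso (biduality h h' j (singleRing R)) := by
  rw [quasiIso_biduality_singleRing_iff]
  have hj : IsIso (DerivedCategory.Q.map j) := inferInstance
  have hval (r : R) : homVal _ ((toIntComplex R).map (homothety h') ≫
      homComplexPostcomp (actionHom ψ φ h' D) j _) 0 (singleRingMk (R := R) r) =
        Cochain.ofHom (actionHom ψ φ h' D r ≫ j) := by
    change Cochain.comp (homVal _ (homothety h' (D := D)) 0 (singleRingMk r)) (Cochain.ofHom j)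
      (add_zero 0) = _
    rw [homVal_homothety, Cochain.ofHom_comp]
  have hJ := CochainComplex.IsKInjective.Qh_map_bijective
    ((HomotopyCategory.quotient _ _).obj (resComplex ψ D)) J
  have hQ (f g : resComplex ψ D ⟶ J) := (exists_δ_eq_iff f g).trans
    (CochainComplex.Q_map_eq_iff _ _ hJ f g).symm
  refine ⟨fun n ↦ ?_⟩
  by_cases hn : n = 0
  · subst hn
    refine ModuleCat.quasiIsoAt_of_forall _ 0 (fun (x : (singleRing R).X 0) hx y hy ↦ ?_)
      fun z hz ↦ ?_
    · obtain ⟨r, hx'⟩ : ∃ r : R, x = singleRingMk r := singleRing_X_surjective x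
      rw [hx'] at hy ⊢
      let y' : Cochain (resComplex ψ D) J (-1) := y
      have hy' : δ (-1) 0 y' = _ := hy.trans (hval r)
      have hr : r = 0 := by
        refine hD.bijective.1 ?_
        -- Zero is written `0 ≫ j` so that the invertible `Q.map j` can be cancelled.
        have := (hQ (actionHom ψ φ h' D r ≫ j) (0 ≫ j)).1 ⟨y', by
          rw [hy', zero_comp, Cochain.ofHom_zero, sub_zero]⟩
        rw [Functor.map_comp, Functor.map_comp, cancel_mono] at this
        dsimp only
        rw [this, map_zero]
      refine ⟨0, ?_⟩
      rw [map_zero, hr]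
      exact (map_zero (HomologicalComplex.singleObjXSelf (.up ℤ) 0 (ModuleCat.of R R)).inv.hom).symm
    · let z' : Cochain (resComplex ψ D) J 0 := z
      obtain ⟨g, hg⟩ : ∃ g : resComplex ψ D ⟶ J, Cochain.ofHom g = z' :=
        ⟨(Cocycle.mk z' 1 (zero_add 1) hz).homOf, Cocycle.cochain_ofHom_homOf_eq_coe _⟩
      obtain ⟨r, hr⟩ := hD.bijective.2 (DerivedCategory.Q.map g ≫ inv (DerivedCategory.Q.map j))
      obtain ⟨y, hy⟩ := (hQ (actionHom ψ φ h' D r ≫ j) g).2 (by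
        rw [Functor.map_comp, ← cancel_mono (inv (DerivedCategory.Q.map j))]
        simpa using hr)
      refine ⟨singleRingMk (R := R) r, ?_, y, ?_⟩
      · exact singleRing_X_eq_zero (R := R) (i := 0 + 1) (by simp) _
      · refine hy.trans ?_
        rw [hg, ← hval]
        rfl
  · refine ModuleCat.quasiIsoAt_of_forall _ n (fun x hx y hy ↦ ?_) fun z hz ↦ ?_
    · exact ⟨0, by rw [map_zero]; exact (singleRing_X_eq_zero (R := R) hn x).symm⟩
    · have hex : (homComplex (intAction J) (resComplex ψ D)).ExactAt n := by
        refine (homComplex_exactAt_iff_Q _ _ _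
          (CochainComplex.IsKInjective.Qh_map_bijective _ _)).2 fun f ↦ ?_
        rw [← cancel_mono ((inv (DerivedCategory.Q.map j))⟦n⟧'), zero_comp]
        exact hD.eq_zero n hn _
      obtain ⟨y, hy⟩ := (ModuleCat.exactAt_iff _ _).1 hex z hz
      exact ⟨0, map_zero _, -y, by rw [map_neg, hy, map_zero, zero_sub]⟩

end homothety

/-! ### Biduality for perfect complexes -/

section perfectBiduality
variable {R S T : Type u} [Ring R] [Ring S] [Ring T] {φ : R →+* T} {ψ : S →+* T}
  (h : ∀ a r, Commute (φ a) (ψ r)) (h' : ∀ r a, Commute (ψ r) (φ a))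
  {D : CochainComplex (ModuleCat.{u} T) ℤ} {J : CochainComplex (ModuleCat.{u} S) ℤ}
  (j : resComplex ψ D ⟶ J) [HasDerivedCategory.{w} (ModuleCat.{u} S)]

lemma acyclic_toIntComplex {K : CochainComplex (ModuleCat.{u} R) ℤ} (hK : K.Acyclic) :
    ((toIntComplex R).obj K).Acyclic := fun n ↦ by
  have := (ModuleCat.exactAt_iff K n).1 (hK n)
  rw [ModuleCat.exactAt_iff]
  exact this

-- Source and target of the biduality map both preserve the short exact sequences with termwise
-- projective quotient, so two-out-of-three applies; the homothety condition enters only for R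
-- itself.
variable {h'} in
lemma containsPerfect_biduality [QuasiIso j] [J.IsKInjective] [∀ i, Injective (J.X i)]
    (hD : IsHomothetyIso (actionHom ψ φ h' D)) :
    ContainsPerfect fun M ↦ QuasiIso (biduality h h' j M) where
  retract {X Y} r hY := by
    let e : RetractArrow (biduality h h' j X) (biduality h h' j Y) :=
      { i := Arrow.homMk ((toIntComplex R).map r.i)
          (homComplexMap (intAction J) (homComplexMap (actionHom φ ψ h D) r.i))
          (biduality_naturality h h' j r.i)
        r := Arrow.homMk ((toIntComplex R).map r.r)
          (homComplexMap (intAction J) (homComplexMap (actionHom φ ψ h D) r.r))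
          (biduality_naturality h h' j r.r)
        retract := by
          ext1
          · change (toIntComplex R).map r.i ≫ (toIntComplex R).map r.r = 𝟙 _
            rw [← Functor.map_comp, r.retract, CategoryTheory.Functor.map_id]
          · change homComplexMap (intAction J) (homComplexMap (actionHom φ ψ h D) r.i) ≫
              homComplexMap (intAction J) (homComplexMap (actionHom φ ψ h D) r.r) = 𝟙 _
            rw [← homComplexMap_comp, ← homComplexMap_comp, r.retract, homComplexMap_id,
              homComplexMap_id] }
    exact quasiIso_of_retractArrow e
  of_isZero {X} hX := CochainComplex.quasiIso_of_acyclic _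
    (acyclic_toIntComplex (CochainComplex.acyclic_of_isZero_quotient hX))
    (CochainComplex.acyclic_of_isZero_quotient
      (isZero_quotient_homComplex _ (isZero_quotient_homComplex _ hX)))
  ext₁ {X} hX hX' h₂ h₃ :=
    have : QuasiIso (bidualityShortComplex h h' j X).τ₂ := h₂
    have : QuasiIso (bidualityShortComplex h h' j X).τ₃ := h₃
    CochainComplex.quasiIso_τ₁ (shortExact_intShortComplex hX)
      (shortExact_homShortComplex_homShortComplex h hX hX') (bidualityShortComplex h h' j X)
  ext₂ {X} hX hX' h₁ h₃ :=
    have : QuasiIso (bidualityShortComplex h h' j X).τ₁ := h₁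
    have : QuasiIso (bidualityShortComplex h h' j X).τ₃ := h₃
    CochainComplex.quasiIso_τ₂ (shortExact_intShortComplex hX)
      (shortExact_homShortComplex_homShortComplex h hX hX') (bidualityShortComplex h h' j X)
  ext₃ {X} hX hX' h₁ h₂ :=
    have : QuasiIso (bidualityShortComplex h h' j X).τ₁ := h₁
    have : QuasiIso (bidualityShortComplex h h' j X).τ₂ := h₂
    CochainComplex.quasiIso_τ₃ (shortExact_intShortComplex hX)
      (shortExact_homShortComplex_homShortComplex h hX hX') (bidualityShortComplex h h' j X)
  single := quasiIso_biduality_singleRing h j hD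

end perfectBiduality

/-! ### Coherence and finitely presented cohomology -/

section fp
variable {R : Type u} [Ring R]

/-- The range of f is a finitely generated submodule of N, hence finitely presented. This makes the
kernel finitely generated in M, and coherence applies again. -/
lemma IsLeftCoherent.finitePresentation_ker [IsLeftCoherent R] {M N : Type u} [AddCommGroup M]
    [AddCommGroup N] [Module R M] [Module R N] [Module.FinitePresentation R M]
    [Module.FinitePresentation R N] (f : M →ₗ[R] N) :
    Module.FinitePresentation R (LinearMap.ker f) := by
  have : Module.FinitePresentation R (LinearMap.range f) :=
    IsLeftCoherent.finitePresentation_of_fg _ _ (Module.Finite.iff_fg.1 inferInstance)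
  have h := Module.FinitePresentation.fg_ker f.rangeRestrict f.surjective_rangeRestrict
  rw [LinearMap.ker_rangeRestrict] at h
  exact IsLeftCoherent.finitePresentation_of_fg _ _ h

/-- M₂ is an extension of ker f₃ by coker f₀. This five-term form is what long exact cohomology
sequences provide. -/
lemma IsLeftCoherent.finitePresentation_of_exact [IsLeftCoherent R] {M₀ M₁ M₂ M₃ M₄ : Type u}
    [AddCommGroup M₀] [AddCommGroup M₁] [AddCommGroup M₂] [AddCommGroup M₃] [AddCommGroup M₄]
    [Module R M₀] [Module R M₁] [Module R M₂] [Module R M₃] [Module R M₄]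
    {f₀ : M₀ →ₗ[R] M₁} {f₁ : M₁ →ₗ[R] M₂} {f₂ : M₂ →ₗ[R] M₃} {f₃ : M₃ →ₗ[R] M₄}
    (e₀ : LinearMap.range f₀ = LinearMap.ker f₁) (e₁ : LinearMap.range f₁ = LinearMap.ker f₂)
    (e₂ : LinearMap.range f₂ = LinearMap.ker f₃)
    [Module.FinitePresentation R M₀] [Module.FinitePresentation R M₁]
    [Module.FinitePresentation R M₃] [Module.FinitePresentation R M₄] :
    Module.FinitePresentation R M₂ := by
  have := finitePresentation_ker f₃
  have : Module.FinitePresentation R (LinearMap.range f₂) := e₂ ▸ this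
  have : Module.FinitePresentation R (LinearMap.range f₁) :=
    Module.finitePresentation_of_surjective f₁.rangeRestrict f₁.surjective_rangeRestrict (by
      rw [LinearMap.ker_rangeRestrict, ← e₀]
      exact Module.Finite.iff_fg.1 inferInstance)
  have : Module.FinitePresentation R (LinearMap.ker f₂.rangeRestrict) := by
    rw [LinearMap.ker_rangeRestrict, ← e₁]
    exact this
  exact Module.finitePresentation_of_ker f₂.rangeRestrict f₂.surjective_rangeRestrict

/-- The cohomology modules of a complex are finitely presented. -/
def HasFpHomology (K : CochainComplex (ModuleCat.{u} R) ℤ) : Prop :=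
  ∀ n, fpModules R (K.homology n)

lemma fpModules_of_isZero {M : ModuleCat.{u} R} (hM : IsZero M) : fpModules R M :=
  ObjectProperty.prop_of_isZero _ hM

lemma fpModules_of_exact [IsLeftCoherent R] {M₀ M₁ M₂ M₃ M₄ : ModuleCat.{u} R}
    {f₀ : M₀ ⟶ M₁} {f₁ : M₁ ⟶ M₂} {f₂ : M₂ ⟶ M₃} {f₃ : M₃ ⟶ M₄} {w₀ : f₀ ≫ f₁ = 0}
    {w₁ : f₁ ≫ f₂ = 0} {w₂ : f₂ ≫ f₃ = 0} (e₀ : (ShortComplex.mk _ _ w₀).Exact)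
    (e₁ : (ShortComplex.mk _ _ w₁).Exact) (e₂ : (ShortComplex.mk _ _ w₂).Exact)
    (h₀ : fpModules R M₀) (h₁ : fpModules R M₁) (h₃ : fpModules R M₃) (h₄ : fpModules R M₄) :
    fpModules R M₂ := by
  have : Module.FinitePresentation R M₀ := h₀
  have : Module.FinitePresentation R M₁ := h₁
  have : Module.FinitePresentation R M₃ := h₃
  have : Module.FinitePresentation R M₄ := h₄
  exact IsLeftCoherent.finitePresentation_of_exact e₀.moduleCat_range_eq_ker
    e₁.moduleCat_range_eq_ker e₂.moduleCat_range_eq_ker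

namespace HasFpHomology

lemma of_quasiIso {K L : CochainComplex (ModuleCat.{u} R) ℤ} (f : K ⟶ L) [QuasiIso f]
    (hK : HasFpHomology K) : HasFpHomology L :=
  fun n ↦ (fpModules R).prop_of_iso (isoOfQuasiIsoAt f n) (hK n)

lemma of_acyclic {K : CochainComplex (ModuleCat.{u} R) ℤ} (hK : K.Acyclic) : HasFpHomology K :=
  fun n ↦ fpModules_of_isZero ((HomologicalComplex.exactAt_iff_isZero_homology _ _).1 (hK n))

variable [IsLeftCoherent R] {X : ShortComplex (CochainComplex (ModuleCat.{u} R) ℤ)}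
  (hX : X.ShortExact)
include hX

lemma ext₁ (h₂ : HasFpHomology X.X₂) (h₃ : HasFpHomology X.X₃) : HasFpHomology X.X₁ := fun n ↦
  fpModules_of_exact (hX.homology_exact₃ (n - 1) n (by simp)) (hX.homology_exact₁ (n - 1) n
      (by simp))
    (hX.homology_exact₂ n) (h₂ (n - 1)) (h₃ (n - 1)) (h₂ n) (h₃ n)

lemma ext₂ (h₁ : HasFpHomology X.X₁) (h₃ : HasFpHomology X.X₃) : HasFpHomology X.X₂ := fun n ↦
  fpModules_of_exact (hX.homology_exact₁ (n - 1) n (by simp)) (hX.homology_exact₂ n)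
    (hX.homology_exact₃ n (n + 1) (by simp)) (h₃ (n - 1)) (h₁ n) (h₃ n) (h₁ (n + 1))

lemma ext₃ (h₁ : HasFpHomology X.X₁) (h₂ : HasFpHomology X.X₂) : HasFpHomology X.X₃ := fun n ↦
  fpModules_of_exact (hX.homology_exact₂ n) (hX.homology_exact₃ n (n + 1) (by simp))
    (hX.homology_exact₁ n (n + 1) (by simp)) (h₁ n) (h₂ n) (h₁ (n + 1)) (h₂ (n + 1))

end HasFpHomology

lemma hasFpHomology_resComplex {S : Type u} [Ring S] (f : R →+* S)
    {D : CochainComplex (ModuleCat.{u} S) ℤ}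
    (hD : ∀ n, fpModules R ((ModuleCat.restrictScalars.{u} f).obj (D.homology n))) :
    HasFpHomology (resComplex f D) := fun n ↦
  (fpModules R).prop_of_iso (((D.sc n).mapHomologyIso (ModuleCat.restrictScalars.{u} f)).symm)
    (hD n)

end fp

/-! ### Duals of perfect complexes have finitely presented cohomology -/

section perfectFp
variable {R S T : Type u} [Ring R] [Ring S] [Ring T] {φ : R →+* T} {ψ : S →+* T}
  (h : ∀ a r, Commute (φ a) (ψ r)) (h' : ∀ r a, Commute (ψ r) (φ a))
  {D : CochainComplex (ModuleCat.{u} T) ℤ} [IsLeftCoherent S]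

/-- The base case is Hom(R, D) ≅ D. The extension cases are long exact sequences, with `ext₁` and
`ext₃` exchanged because Hom(-, D) is contravariant. -/
lemma containsPerfect_hasFpHomology_homComplex (hD : HasFpHomology (resComplex ψ D)) :
    ContainsPerfect fun M ↦ HasFpHomology (homComplex (actionHom φ ψ h D) M) where
  retract {X Y} r hY n := by
    have : Module.FinitePresentation S ((homComplex (actionHom φ ψ h D) Y).homology n) := hY n
    let i := HomologicalComplex.homologyMap (homComplexMap (actionHom φ ψ h D) r.r) n
    let p := HomologicalComplex.homologyMap (homComplexMap (actionHom φ ψ h D) r.i) n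
    have hip : i ≫ p = 𝟙 _ := by
      dsimp only [i, p]
      rw [← HomologicalComplex.homologyMap_comp, ← homComplexMap_comp, r.retract, homComplexMap_id,
        HomologicalComplex.homologyMap_id]
    have hs (x) : p.hom (i.hom x) = x := ConcreteCategory.congr_hom hip x
    refine Module.finitePresentation_of_surjective p.hom (fun x ↦ ⟨_, hs x⟩) ?_
    -- The kernel of a split surjection is the image of the complementary idempotent, hence finitely
    -- generated.
    have : LinearMap.ker p.hom = LinearMap.range (LinearMap.id - i.hom.comp p.hom) := by
      ext x
      refine ⟨fun hx ↦ ⟨x, ?_⟩, ?_⟩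
      · simp [LinearMap.mem_ker.1 hx]
      · rintro ⟨y, rfl⟩
        simp [hs]
    rw [this]
    exact Module.Finite.iff_fg.1 inferInstance
  of_isZero hX := .of_acyclic (CochainComplex.acyclic_of_isZero_quotient
    (isZero_quotient_homComplex _ hX))
  ext₁ hX hX' h₂ h₃ := HasFpHomology.ext₃ (homShortComplex_shortExact (actionHom φ ψ h D) hX
    fun i _ ↦ exists_extension_of_projective hX i) h₃ h₂
  ext₂ hX hX' h₁ h₃ := HasFpHomology.ext₂ (homShortComplex_shortExact (actionHom φ ψ h D) hX
    fun i _ ↦ exists_extension_of_projective hX i) h₃ h₁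
  ext₃ hX hX' h₁ h₂ := HasFpHomology.ext₁ (homShortComplex_shortExact (actionHom φ ψ h D) hX
    fun i _ ↦ exists_extension_of_projective hX i) h₂ h₁
  single := .of_quasiIso (toHomSingleRing h (fun r a ↦ (h a r).symm)) hD

end perfectFp

/-! ### Comparing cohomology in a single degree -/

section shortExact
variable {C : Type u} [Category.{v} C] [Abelian C] {X X' : ShortComplex (CochainComplex C ℤ)}
  (hX : X.ShortExact) (hX' : X'.ShortExact)
include hX

lemma CategoryTheory.ShortComplex.ShortExact.isIso_homologyMap_f (n : ℤ)
    (h : X.X₃.ExactAt (n - 1)) (h' : X.X₃.ExactAt n) :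
    IsIso (HomologicalComplex.homologyMap X.f n) := by
  rw [HomologicalComplex.exactAt_iff_isZero_homology] at h h'
  have : Mono (HomologicalComplex.homologyMap X.f n) :=
    (hX.homology_exact₁ (n - 1) n (by simp)).mono_g (h.eq_of_src _ _)
  have : Epi (HomologicalComplex.homologyMap X.f n) :=
    (hX.homology_exact₂ n).epi_f (h'.eq_of_tgt _ _)
  exact isIso_of_mono_of_epi _

lemma CategoryTheory.ShortComplex.ShortExact.isIso_homologyMap_g (n : ℤ)
    (h : X.X₁.ExactAt n) (h' : X.X₁.ExactAt (n + 1)) :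
    IsIso (HomologicalComplex.homologyMap X.g n) := by
  rw [HomologicalComplex.exactAt_iff_isZero_homology] at h h'
  have : Mono (HomologicalComplex.homologyMap X.g n) :=
    (hX.homology_exact₂ n).mono_g (h.eq_of_src _ _)
  have : Epi (HomologicalComplex.homologyMap X.g n) :=
    (hX.homology_exact₃ n (n + 1) (by simp)).epi_f (h'.eq_of_tgt _ _)
  exact isIso_of_mono_of_epi _

-- Exactness of the third terms in degrees n - 1 and n identifies H^n of the first two terms in each
-- sequence, so `f.τ₁` decides.
include hX' in
lemma CochainComplex.quasiIsoAt_τ₂ (f : X ⟶ X') [QuasiIso f.τ₁] (n : ℤ)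
    (h : X.X₃.ExactAt (n - 1)) (h' : X.X₃.ExactAt n)
    (h₁ : X'.X₃.ExactAt (n - 1)) (h₁' : X'.X₃.ExactAt n) : QuasiIsoAt f.τ₂ n := by
  have := hX.isIso_homologyMap_f n h h'
  have := hX'.isIso_homologyMap_f n h₁ h₁'
  rw [quasiIsoAt_iff_isIso_homologyMap]
  have e : HomologicalComplex.homologyMap X.f n ≫ HomologicalComplex.homologyMap f.τ₂ n =
      HomologicalComplex.homologyMap f.τ₁ n ≫ HomologicalComplex.homologyMap X'.f n := by
    rw [← HomologicalComplex.homologyMap_comp, ← HomologicalComplex.homologyMap_comp, f.comm₁₂]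
  have : IsIso (HomologicalComplex.homologyMap X.f n ≫ HomologicalComplex.homologyMap f.τ₂ n) := by
    rw [e]
    infer_instance
  exact IsIso.of_isIso_comp_left (HomologicalComplex.homologyMap X.f n) _

end shortExact

/-! ### Injective dimension and way-out bounds -/

section wayOut
variable {C : Type v} [Category.{u} C] [Abelian C] [HasDerivedCategory.{w} C]

/-- There are no nonzero morphisms from objects in degrees `≥ c` to the `n`-th shift of `Y` if
`n > b - c`. -/
def DerivedCategory.HasInjectiveDimensionLE (Y : DerivedCategory C) (b : ℤ) : Prop :=
  ∀ (X : DerivedCategory C) (c n : ℤ), X.IsGE c → b < n + c → ∀ f : X ⟶ Y⟦n⟧, f = 0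

lemma DerivedCategory.HasInjectiveDimensionLE.of_iso {Y Y' : DerivedCategory C} (e : Y ≅ Y') {b : ℤ}
    (hY : Y.HasInjectiveDimensionLE b) : Y'.HasInjectiveDimensionLE b := fun X c n hX h f ↦ by
  rw [← cancel_mono (e.inv⟦n⟧'), zero_comp]
  exact hY X c n hX h _

/-- Represent X by a complex in degrees ≥ c. As I⟦n⟧ lives in degrees ≤ b - n < c, every chain map
to it is zero. -/
lemma hasInjectiveDimensionLE_Q_obj (I : CochainComplex C ℤ) (b : ℤ) [I.IsStrictlyLE b]
    [I.IsKInjective] : (DerivedCategory.Q.obj I).HasInjectiveDimensionLE b := fun X c n _ h f ↦ by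
  obtain ⟨M, _, ⟨e⟩⟩ := DerivedCategory.exists_iso_Q_obj_of_isGE X c
  obtain ⟨g, hg⟩ := CochainComplex.exists_Q_map_eq M (I⟦n⟧)
    (CochainComplex.IsKInjective.Qh_map_bijective _ _)
    (e.inv ≫ f ≫ (DerivedCategory.Q.commShiftIso n).inv.app I)
  have : g = 0 := by
    ext1 i
    by_cases hi : i < c
    · exact (M.isZero_of_isStrictlyGE c i hi).eq_of_src _ _
    · have hI : IsZero ((I⟦n⟧).X i) := I.isZero_of_isStrictlyLE b (i + n) (by lia)
      exact hI.eq_of_tgt _ _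
  rw [this, Functor.map_zero] at hg
  rw [← cancel_epi e.inv, ← cancel_mono ((DerivedCategory.Q.commShiftIso n).inv.app I),
    Category.assoc, ← hg, comp_zero, zero_comp]

namespace HasFiniteInjectiveModel
variable {K : CochainComplex C ℤ} (hK : HasFiniteInjectiveModel K)
include hK

lemma exists_hasInjectiveDimensionLE : ∃ b, (DerivedCategory.Q.obj K).HasInjectiveDimensionLE b :=
    by
  obtain ⟨I, a, b, _, _, _, ⟨e⟩⟩ := hK
  have := CochainComplex.isKInjective_of_injective I a
  exact ⟨b, (hasInjectiveDimensionLE_Q_obj I b).of_iso e.symm⟩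

lemma exists_isGE : ∃ a, (DerivedCategory.Q.obj K).IsGE a := by
  obtain ⟨I, a, b, _, _, _, ⟨e⟩⟩ := hK
  exact ⟨a, DerivedCategory.TStructure.t.isGE_of_iso e.symm a⟩

lemma exists_quasiIso : ∃ (J : CochainComplex C ℤ) (j : K ⟶ J), J.IsKInjective ∧ QuasiIso j ∧
    (∀ i, Injective (J.X i)) := by
  obtain ⟨I, a, b, _, _, hI, ⟨e⟩⟩ := hK
  have := CochainComplex.isKInjective_of_injective I a
  obtain ⟨j, hj⟩ := CochainComplex.exists_Q_map_eq K I
    (CochainComplex.IsKInjective.Qh_map_bijective _ _) e.hom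
  refine ⟨I, j, this, ?_, hI⟩
  rw [← DerivedCategory.isIso_Q_map_iff_quasiIso, hj]
  infer_instance

end HasFiniteInjectiveModel

variable {R : Type u} [Ring R] {D : CochainComplex C ℤ} (ρ : R →+* End D) {M : CochainComplex C ℤ}

lemma homComplex_isLE
    (hMD : ∀ n : ℤ, Function.Bijective (DerivedCategory.Qh.map :
      ((HomotopyCategory.quotient C (.up ℤ)).obj M ⟶
        (HomotopyCategory.quotient C (.up ℤ)).obj (D⟦n⟧)) → _)) {b c d : ℤ} (hd : b - c ≤ d)
    (hD : (DerivedCategory.Q.obj D).HasInjectiveDimensionLE b) [M.IsGE c] :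
    (homComplex ρ M).IsLE d := by
  rw [CochainComplex.isLE_iff]
  exact fun n hn ↦ (homComplex_exactAt_iff_Q ρ M n (hMD n)).2 fun f ↦
    hD _ c n inferInstance (by lia) f

/-- D⟦n⟧ lies in degrees ≥ a - n > d when n < c, so orthogonality in the t-structure kills all maps
from M. -/
lemma homComplex_isGE
    (hMD : ∀ n : ℤ, Function.Bijective (DerivedCategory.Qh.map :
      ((HomotopyCategory.quotient C (.up ℤ)).obj M ⟶
        (HomotopyCategory.quotient C (.up ℤ)).obj (D⟦n⟧)) → _)) {a d c : ℤ} (hc : c ≤ a - d)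
    (hD : (DerivedCategory.Q.obj D).IsGE a) [M.IsLE d] :
    (homComplex ρ M).IsGE c := by
  rw [CochainComplex.isGE_iff]
  exact fun n hn ↦ (homComplex_exactAt_iff_Q ρ M n (hMD n)).2 fun f ↦
    have := DerivedCategory.TStructure.t.isGE_shift (DerivedCategory.Q.obj D) a n (a - n)
    DerivedCategory.TStructure.t.zero f d (a - n)

end wayOut

/-! ### From perfect complexes to complexes unbounded below -/

section
variable {R S T : Type u} [Ring R] [Ring S] [Ring T] {φ : R →+* T} {ψ : S →+* T}
  (h : ∀ a r, Commute (φ a) (ψ r)) (h' : ∀ r a, Commute (ψ r) (φ a))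
  {D : CochainComplex (ModuleCat.{u} T) ℤ}

lemma IsFinProj.isKProjective {P : CochainComplex (ModuleCat.{u} R) ℤ}
    (hP : IsFinProj P) (d : ℤ) [P.IsStrictlyLE d] : P.IsKProjective :=
  have := hP.projective
  CochainComplex.isKProjective_of_projective P d

variable {P : CochainComplex (ModuleCat.{u} R) ℤ} (hP : IsFinProj P) (d : ℤ) [P.IsStrictlyLE d]
  [HasDerivedCategory.{w} (ModuleCat.{u} R)]
include hP

lemma IsFinProj.homComplex_brutalLT_isGE (N : ℤ) {a c : ℤ} (hc : c ≤ a - N)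
    (hD : (DerivedCategory.Q.obj (resComplex φ D)).IsGE a) :
    (homComplex (actionHom φ ψ h D) (_root_.brutalLT P N)).IsGE c :=
  have := (hP.brutalLT N).isKProjective (N - 1)
  -- The truncation stops at N - 1, so the bound a - N has one degree to spare.
  homComplex_isGE (d := N - 1) _
    (fun _ ↦ CochainComplex.IsKProjective.Qh_map_bijective _ _) (by lia) hD

include d in
lemma IsFinProj.hasFpHomology_homComplex [IsLeftCoherent S]
    (hD : HasFiniteInjectiveModel (resComplex φ D)) (hD' : HasFpHomology (resComplex ψ D)) :
    HasFpHomology (homComplex (actionHom φ ψ h D) P) := fun n ↦ by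
  obtain ⟨a, ha⟩ := hD.exists_isGE
  -- With this N the dual of the part of P in degrees < N lives in degrees ≥ n + 2. It is exact in
  -- degrees n and n + 1, so H^n of the dual of P is that of its bounded part.
  let N := a - (n + 2)
  have := hP.homComplex_brutalLT_isGE h N (show n + 2 ≤ _ by lia) ha
  have hLT (i : ℤ) : Projective ((brutalShortComplex P N).X₃.X i) := (hP.brutalLT N).projective i
  have hX := homShortComplex_shortExact (actionHom φ ψ h D) (brutalShortComplex_shortExact P N)
    fun i _ ↦ exists_extension_of_projective (brutalShortComplex_shortExact P N) i
  have := hX.isIso_homologyMap_g n (CochainComplex.exactAt_of_isGE (homComplex _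
      (_root_.brutalLT P N)) (n + 2) n (by lia))
    (CochainComplex.exactAt_of_isGE (homComplex _ (_root_.brutalLT P N)) (n + 2) (n + 1) (by lia))
  exact (fpModules S).prop_of_iso
    (asIso (HomologicalComplex.homologyMap (homShortComplex (actionHom φ ψ h D)
        (brutalShortComplex P N)).g n)).symm
    ((containsPerfect_hasFpHomology_homComplex h hD').of_bounded (_root_.brutalGE P N)
        (hP.brutalGE N) N d n)

variable [HasDerivedCategory.{w} (ModuleCat.{u} S)]
-- A way-out argument in each degree n: for N small enough, the part of P in degrees < N and its
-- double dual are exact in degrees n - 1 and n, and the rest of P is perfect.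
include d in
variable {h'} in
lemma IsFinProj.quasiIso_biduality {J : CochainComplex (ModuleCat.{u} S) ℤ}
    (j : resComplex ψ D ⟶ J) [QuasiIso j] [J.IsKInjective] [hJ : ∀ i, Injective (J.X i)]
    (hD₁ : HasFiniteInjectiveModel (resComplex φ D))
    (hD₂ : HasFiniteInjectiveModel (resComplex ψ D))
    (hD : IsHomothetyIso (actionHom ψ φ h' D)) :
    QuasiIso (biduality h h' j P) := ⟨fun n ↦ by
  obtain ⟨a, ha⟩ := hD₁.exists_isGE
  obtain ⟨b, hb⟩ := hD₂.exists_hasInjectiveDimensionLE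
  replace hb := hb.of_iso (asIso (DerivedCategory.Q.map j))
  -- The dual of the lower part is in degrees ≥ a - N, so its double dual is in degrees ≤ b - (a -
  -- N). The second inequality makes the lower part itself vanish in degrees n - 1 and n.
  obtain ⟨N, hN, hN'⟩ : ∃ N : ℤ, b - (a - N) ≤ n - 2 ∧ N ≤ n - 2 :=
    ⟨min (n - 2) (n - 2 - b + a), by lia, by lia⟩
  have := hP.homComplex_brutalLT_isGE h N le_rfl ha
  have hLT (i : ℤ) : Projective ((brutalShortComplex P N).X₃.X i) := (hP.brutalLT N).projective i
  have hL : (homComplex (intAction J) (homComplex (actionHom φ ψ h D) (_root_.brutalLT P N))).IsLE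
      (n - 2) :=
    homComplex_isLE _ (fun _ ↦ CochainComplex.IsKInjective.Qh_map_bijective _ _) hN hb
  have hL' (i : ℤ) (hi : N ≤ i) : ((toIntComplex R).obj (_root_.brutalLT P N)).ExactAt i := by
    rw [ModuleCat.exactAt_iff]
    intro x _
    have := ModuleCat.subsingleton_of_isZero
      ((_root_.brutalLT P N).isZero_of_isStrictlyLE (N - 1) i (by lia))
    exact ⟨0, Subsingleton.elim (α := (_root_.brutalLT P N).X i) _ _⟩
  have hX := brutalShortComplex_shortExact P N
  have : QuasiIso (bidualityShortComplex h h' j (brutalShortComplex P N)).τ₁ :=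
    (containsPerfect_biduality h j hD).of_bounded (_root_.brutalGE P N) (hP.brutalGE N) N d
  exact CochainComplex.quasiIsoAt_τ₂ (shortExact_intShortComplex hX)
    (shortExact_homShortComplex_homShortComplex h hX hLT)
    (bidualityShortComplex h h' j (brutalShortComplex P N)) n (hL' _ (by lia)) (hL' _ (by lia))
    (CochainComplex.exactAt_of_isLE
      (homComplex (intAction J) (homComplex (actionHom φ ψ h D) (_root_.brutalLT P N))) (n - 2)
          (n - 1) (by lia))
    (CochainComplex.exactAt_of_isLE
      (homComplex (intAction J) (homComplex (actionHom φ ψ h D) (_root_.brutalLT P N)))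
          (n - 2) n (by lia))⟩

end

/-! ### Projective finitely presented modules -/

section fpProjective
variable {R : Type u} [Ring R] [IsLeftCoherent R]

lemma FpModuleCat.projective_of_projective (X : FpModuleCat R) [Projective X.obj] : Projective X :=
  (fpModules R).ι.projective_of_map_projective ‹Projective X.obj›

lemma FpModuleCat.exists_epi (X : FpModuleCat R) :
    ∃ (P : FpModuleCat R) (f : P ⟶ X), Projective P ∧ Projective P.obj ∧ Epi f := by
  have : Module.FinitePresentation R X.obj := X.property
  obtain ⟨k, f, hf⟩ := Module.Finite.exists_fin' R X.obj
  let P : FpModuleCat R := ⟨ModuleCat.of R (Fin k → R),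
    inferInstanceAs (Module.FinitePresentation R (Fin k → R))⟩
  have hP : Projective P.obj := inferInstanceAs (Projective (ModuleCat.of R (Fin k → R)))
  let g : P ⟶ X := (fpModules R).fullyFaithfulι.preimage (X := P) (ModuleCat.ofHom f)
  refine ⟨P, g, FpModuleCat.projective_of_projective P, hP, (fpModules R).ι.epi_of_epi_map ?_⟩
  exact (ModuleCat.epi_iff_surjective (ModuleCat.ofHom f)).2 hf

instance : EnoughProjectives (FpModuleCat R) where
  presentation X := by
    obtain ⟨P, f, h₁, _, h₂⟩ := X.exists_epi
    exact ⟨⟨P, f⟩⟩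

/-- Lifting the identity through a surjection from a finite free module shows that X is a retract of
it. -/
instance (X : FpModuleCat R) [Projective X] : Projective X.obj := by
  obtain ⟨P, f, _, _, _⟩ := X.exists_epi
  let r : Retract X P := { i := Projective.factorThru (𝟙 X) f, r := f }
  exact Retract.projective (Y := P.obj) (r.map (fpModules R).ι)

/-- The complex of modules underlying a complex of finitely presented modules. -/
noncomputable abbrev fpComplex (K : CochainComplex (FpModuleCat R) ℤ) :
    CochainComplex (ModuleCat.{u} R) ℤ :=
  ((fpModules R).ι.mapHomologicalComplex (.up ℤ)).obj K

lemma isFinProj_fpComplex (K : CochainComplex (FpModuleCat R) ℤ) [∀ i, Projective (K.X i)] :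
    IsFinProj (fpComplex K) := fun i ↦ by
  have : Module.FinitePresentation R (K.X i).obj := (K.X i).property
  have : Projective (K.X i).obj := inferInstance
  exact ⟨inferInstanceAs (Module.Finite R (K.X i).obj),
    (IsProjective.iff_projective (K.X i).obj).2 this⟩

end fpProjective

/-! ### Full faithfulness on derived categories -/

section exactFunctor
variable {C₁ : Type*} [Category* C₁] [Abelian C₁] [HasDerivedCategory C₁]
  {C₂ : Type*} [Category* C₂] [Abelian C₂] [HasDerivedCategory C₂]
  (F : C₁ ⥤ C₂) [F.Additive] [PreservesFiniteLimits F] [PreservesFiniteColimits F]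
  [F.Full] [F.Faithful]

/-- F is fully faithful on homotopy categories and commutes with localization; three bijective sides
of the square give the fourth. -/
lemma CategoryTheory.Functor.mapDerivedCategory_map_bijective_Qh
    (K L : HomotopyCategory C₁ (.up ℤ))
    (h₁ : Function.Bijective (DerivedCategory.Qh.map : (K ⟶ L) → _))
    (h₂ : Function.Bijective (DerivedCategory.Qh.map :
      ((F.mapHomotopyCategory (.up ℤ)).obj K ⟶ (F.mapHomotopyCategory (.up ℤ)).obj L) → _)) :
    Function.Bijective (F.mapDerivedCategory.map :
      (DerivedCategory.Qh.obj K ⟶ DerivedCategory.Qh.obj L) → _) := by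
  rw [← Function.Bijective.of_comp_iff _ h₁,
    ← Function.Bijective.of_comp_iff' ((F.mapDerivedCategoryFactorsh.app K).homCongr
      (F.mapDerivedCategoryFactorsh.app L)).bijective]
  refine Eq.mpr (congrArg Function.Bijective (funext fun f ↦ ?_))
    (h₂.comp ((Functor.FullyFaithful.ofFullyFaithful
      (F.mapHomotopyCategory (.up ℤ))).map_bijective K L))
  change F.mapDerivedCategoryFactorsh.inv.app K ≫
    F.mapDerivedCategory.map (DerivedCategory.Qh.map f) ≫
      F.mapDerivedCategoryFactorsh.hom.app L = DerivedCategory.Qh.map _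
  rw [← cancel_epi (F.mapDerivedCategoryFactorsh.hom.app K), Iso.hom_inv_id_app_assoc]
  exact F.mapDerivedCategoryFactorsh.hom.naturality f

lemma CategoryTheory.Functor.map_bijective_of_iso {D₁ D₂ : Type*} [Category* D₁] [Category* D₂]
    (G : D₁ ⥤ D₂) {X X' Y Y' : D₁} (e : X ≅ X') (e' : Y ≅ Y')
    (h : Function.Bijective (G.map : (X ⟶ Y) → _)) :
    Function.Bijective (G.map : (X' ⟶ Y') → _) := by
  convert (((G.mapIso e).homCongr (G.mapIso e')).bijective.comp h).comp
    (e.homCongr e').symm.bijective using 1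
  ext f
  simp

end exactFunctor

section fpDerived
variable {R : Type u} [Ring R] [IsLeftCoherent R] [HasDerivedCategory.{w} (FpModuleCat R)]

lemma FpModuleCat.exists_resolution (X : DerivedCategory (FpModuleCat R)) (d : ℤ) [X.IsLE d] :
    ∃ P : CochainComplex (FpModuleCat R) ℤ, P.IsStrictlyLE d ∧ (∀ i, Projective (P.X i)) ∧
      Nonempty (DerivedCategory.Q.obj P ≅ X) := by
  obtain ⟨K, _, ⟨e⟩⟩ := DerivedCategory.exists_iso_Q_obj_of_isLE X d
  obtain ⟨P, f, h₁, h₂, _⟩ := exists_projective_resolution K d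
  exact ⟨P, h₁, h₂, ⟨asIso (DerivedCategory.Q.map f) ≪≫ e.symm⟩⟩

variable [HasDerivedCategory.{w} (ModuleCat.{u} R)]

/-- A resolution of X by projective finitely presented modules stays K-projective among all modules,
so both groups of morphisms are groups of homotopy classes. No bound on Y is needed. -/
lemma FpModuleCat.mapDerivedCategory_map_bijective (X Y : DerivedCategory (FpModuleCat R)) (d : ℤ)
    [X.IsLE d] :
    Function.Bijective ((fpModules R).ι.mapDerivedCategory.map : (X ⟶ Y) → _) := by
  obtain ⟨P, _, hP, ⟨e⟩⟩ := FpModuleCat.exists_resolution X d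
  have := CochainComplex.isKProjective_of_projective P d
  have : (fpComplex P).IsKProjective := (isFinProj_fpComplex P).isKProjective d
  refine Functor.map_bijective_of_iso _ ((DerivedCategory.quotientCompQhIso _).app P ≪≫ e)
    (DerivedCategory.Qh.objObjPreimageIso Y)
    (Functor.mapDerivedCategory_map_bijective_Qh _ _ _
      (CochainComplex.IsKProjective.Qh_map_bijective _ _)
      (CochainComplex.IsKProjective.Qh_map_bijective (fpComplex P) _))

/-- The lower bound c is cohomological only: the resolution may have nonzero terms in arbitrarily
negative degrees. -/
lemma FpModuleCat.exists_isFinProj (X : DerivedCategory.Bounded (FpModuleCat R)) :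
    ∃ (P : CochainComplex (ModuleCat.{u} R) ℤ) (c d : ℤ), P.IsGE c ∧ P.IsStrictlyLE d ∧
      IsFinProj P ∧
      Nonempty (DerivedCategory.Q.obj P ≅ (fpModules R).ι.mapDerivedCategory.obj X.obj) := by
  obtain ⟨X, ⟨c, hc⟩, ⟨d, hd⟩⟩ := X
  obtain ⟨P, _, hP, ⟨e⟩⟩ := FpModuleCat.exists_resolution X d
  have : P.IsGE c := by
    rw [← DerivedCategory.isGE_Q_obj_iff]
    exact DerivedCategory.TStructure.t.isGE_of_iso e.symm c
  refine ⟨fpComplex P, c, d, ?_, inferInstance, isFinProj_fpComplex P,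
    ⟨((fpModules R).ι.mapDerivedCategoryFactors.app P).symm ≪≫
      (fpModules R).ι.mapDerivedCategory.mapIso e⟩⟩
  rw [CochainComplex.isGE_iff]
  intro i hi
  exact (P.exactAt_of_isGE c i hi).map (fpModules R).ι

instance : (fpToMinus R).Full where
  map_surjective {X Y} f := by
    obtain ⟨⟨X, hX, d, hd⟩, ⟨Y, hY⟩⟩ := X, Y
    obtain ⟨g, hg⟩ := (FpModuleCat.mapDerivedCategory_map_bijective X Y d).2 f.hom
    exact ⟨⟨g⟩, by ext; exact hg⟩

instance : (fpToMinus R).Faithful where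
  map_injective {X Y} f g hfg := by
    obtain ⟨⟨X, hX, d, hd⟩, ⟨Y, hY⟩⟩ := X, Y
    refine InducedCategory.hom_ext ((FpModuleCat.mapDerivedCategory_map_bijective X Y d).1 ?_)
    exact congrArg (fun f ↦ f.hom) hfg

end fpDerived

/-! ### Bounded objects with finitely presented cohomology -/

section essImage
variable {R : Type u} [Ring R] [IsLeftCoherent R] [HasDerivedCategory.{w} (FpModuleCat R)]
  [HasDerivedCategory.{w} (ModuleCat.{u} R)]

open DerivedCategory Pretriangulated

/-- The functor from the bounded derived category of finitely presented modules to the derived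
category of modules. -/
noncomputable abbrev fpToDerived (R : Type u) [Ring R] [IsLeftCoherent R]
    [HasDerivedCategory.{w} (FpModuleCat R)] [HasDerivedCategory.{w} (ModuleCat.{u} R)] :
    DerivedCategory.Bounded (FpModuleCat R) ⥤ DerivedCategory (ModuleCat.{u} R) :=
  DerivedCategory.Bounded.ι ⋙ (fpModules R).ι.mapDerivedCategory

instance : (fpToDerived R).Full :=
  inferInstanceAs (fpToMinus R ⋙ DerivedCategory.Minus.ι).Full

/-- Fullness lets a map between objects of the image be lifted, so its cone stays in the image. -/
instance : (fpToDerived R).essImage.IsTriangulated :=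
  inferInstanceAs (Functor.essImage
    (TStructure.t.bounded.ι ⋙ (fpModules R).ι.mapDerivedCategory)).IsTriangulated

lemma essImage_singleFunctor_obj (M : ModuleCat.{u} R) (hM : fpModules R M) (n : ℤ) :
    (fpToDerived R).essImage ((singleFunctor _ n).obj M) :=
  ⟨⟨(singleFunctor _ n).obj ⟨M, hM⟩, ⟨n, inferInstance⟩, ⟨n, inferInstance⟩⟩,
    ⟨((fpModules R).ι.mapDerivedCategorySingleFunctor n).app ⟨M, hM⟩⟩⟩

/-- Induction on the amplitude along truncation triangles: the top piece is one finitely presented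
module in degree b, and the essential image is closed under extensions. -/
lemma essImage_of_isGE_of_isLE (Y : DerivedCategory (ModuleCat.{u} R)) (a b : ℤ) [Y.IsGE a]
    [Y.IsLE b] (hY : ∀ n, fpModules R ((homologyFunctor _ n).obj Y)) :
    (fpToDerived R).essImage Y := by
  obtain ⟨n, hn⟩ : ∃ n : ℕ, b - a < n := ⟨(b - a + 1).toNat, by lia⟩
  induction n generalizing Y b with
  | zero => exact ObjectProperty.prop_of_isZero _ (TStructure.t.isZero Y b a)
  | succ n hn' =>
    obtain ⟨X, Z, hX, hZ, f, g, δ, hT⟩ := TStructure.t.exists_triangle Y (b - 1) b (by lia)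
    have hX : X.IsLE (b - 1) := ⟨hX⟩
    have hZ : Z.IsGE b := ⟨hZ⟩
    have isoX (i : ℤ) (hi : i < b) : IsIso ((homologyFunctor _ i).map f) := by
      have h₁ := Z.isZero_of_isGE b i hi
      have h₂ := Z.isZero_of_isGE b (i - 1) (by lia)
      have : Epi ((homologyFunctor _ i).map f) :=
        (HomologySequence.exact₂ _ hT i).epi_f (h₁.eq_of_tgt _ _)
      have : Mono ((homologyFunctor _ i).map f) :=
        (HomologySequence.exact₁ _ hT (i - 1) i).mono_g (h₂.eq_of_src _ _)
      exact isIso_of_mono_of_epi _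
    have isoZ (i : ℤ) (hi : b ≤ i) : IsIso ((homologyFunctor _ i).map g) := by
      have h₁ := X.isZero_of_isLE (b - 1) i (by lia)
      have h₂ := X.isZero_of_isLE (b - 1) (i + 1) (by lia)
      have : Mono ((homologyFunctor _ i).map g) :=
        (HomologySequence.exact₂ _ hT i).mono_g (h₁.eq_of_src _ _)
      have : Epi ((homologyFunctor _ i).map g) :=
        (HomologySequence.exact₃ _ hT i (i + 1)).epi_f (h₂.eq_of_tgt _ _)
      exact isIso_of_mono_of_epi _
    have hZ' : Z.IsLE b := by
      rw [DerivedCategory.isLE_iff]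
      intro i hi
      have := isoZ i hi.le
      exact (Y.isZero_of_isLE b i hi).of_iso (asIso ((homologyFunctor _ i).map g)).symm
    have hX' : X.IsGE a := by
      rw [DerivedCategory.isGE_iff]
      intro i hi
      by_cases hi' : i < b
      · have := isoX i hi'
        exact (Y.isZero_of_isGE a i hi).of_iso (asIso ((homologyFunctor _ i).map f))
      · exact X.isZero_of_isLE (b - 1) i (by lia)
    refine (fpToDerived R).essImage.ext_of_isTriangulatedClosed₂ _ hT
      (hn' X (b - 1) (fun i ↦ ?_) (by lia)) ?_
    · by_cases hi' : i < b
      · have := isoX i hi'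
        exact (fpModules R).prop_of_iso (asIso ((homologyFunctor _ i).map f)).symm (hY i)
      · exact fpModules_of_isZero (X.isZero_of_isLE (b - 1) i (by lia))
    · obtain ⟨M, ⟨e⟩⟩ := Z.exists_iso_singleFunctor_obj_of_isGE_of_isLE b
      refine (fpToDerived R).essImage.prop_of_iso e.symm (essImage_singleFunctor_obj M ?_ b)
      have := isoZ b le_rfl
      exact (fpModules R).prop_of_iso ((asIso ((homologyFunctor _ b).map g)) ≪≫
        (homologyFunctor _ b).mapIso e ≪≫ (singleFunctorCompHomologyFunctorIso _ b).app M) (hY b)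

lemma essImage_Q_obj (K : CochainComplex (ModuleCat.{u} R) ℤ) (a b : ℤ) [K.IsGE a] [K.IsLE b]
    (hK : HasFpHomology K) : (fpToDerived R).essImage (Q.obj K) :=
  essImage_of_isGE_of_isLE _ a b fun n ↦
    (fpModules R).prop_of_iso ((homologyFunctorFactors _ n).app K).symm (hK n)

end essImage

/-! ### Anti-equivalences from transpositions -/

section antiequivalence
variable {A B X Y : Type*} [Category* A] [Category* B] [Category* X] [Category* Y]
  (T : A ⥤ X) (U : B ⥤ Y) (F : Aᵒᵖ ⥤ Y) (G : Bᵒᵖ ⥤ X)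

/-- A natural transformation `Hom(U b, F a) → Hom(T a, G b)` which preserves isomorphisms. -/
structure Transposition where
  /-- the map on morphisms -/
  map {a : A} {b : B} (f : U.obj b ⟶ F.obj (op a)) : T.obj a ⟶ G.obj (op b)
  map_comp_left {a : A} {b b' : B} (u : b' ⟶ b) (f : U.obj b ⟶ F.obj (op a)) :
    map (U.map u ≫ f) = map f ≫ G.map u.op
  map_comp_right {a a' : A} {b : B} (u : a' ⟶ a) (f : U.obj b ⟶ F.obj (op a)) :
    map (f ≫ F.map u.op) = T.map u ≫ map f
  isIso {a : A} {b : B} (f : U.obj b ⟶ F.obj (op a)) [IsIso f] : IsIso (map f)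

variable {T U F G}

/-- If `F` lifts to `F'` and `G` lifts to `G'`, then the identity functor is isomorphic to the
composition of `F'` and `G'` if there is a transposition. -/
noncomputable def Transposition.unitIso [T.Full] [T.Faithful] (t : Transposition T U F G)
    {F' : Aᵒᵖ ⥤ B} {G' : Bᵒᵖ ⥤ A} (eF : F' ⋙ U ≅ F) (eG : G' ⋙ T ≅ G) :
    𝟭 A ≅ F'.rightOp ⋙ G' :=
  have (a : A) : IsIso (t.map (eF.hom.app (op a))) := t.isIso _
  Functor.fullyFaithfulCancelRight T
    -- The component at a transposes U(F' a) ≅ F a into T a ≅ G(F' a), then uses that G' lifts G.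
    (NatIso.ofComponents (fun a ↦ asIso (t.map (eF.hom.app (op a))) ≪≫
      (eG.symm.app (op (F'.obj (op a))))) fun {a' a} u ↦ by
      change T.map u ≫ t.map (eF.hom.app (op a)) ≫ eG.inv.app (op (F'.obj (op a))) =
        (t.map (eF.hom.app (op a')) ≫ eG.inv.app (op (F'.obj (op a')))) ≫
          T.map (G'.map (F'.map u.op).op)
      have e := eF.hom.naturality u.op
      have e' := eG.inv.naturality (F'.map u.op).op
      dsimp at e e'
      rw [← Category.assoc, ← t.map_comp_right, ← e, t.map_comp_left, Category.assoc,
        Category.assoc, e'])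

/-- Each transposition yields one of the two natural isomorphisms. They need not be mutually
inverse, since `Equivalence.mk` corrects the unit to obtain the triangle identity. -/
lemma exists_equivalence_of_transposition [T.Full] [T.Faithful] [U.Full] [U.Faithful]
    (t : Transposition T U F G) (s : Transposition U T G F)
    (hF : ∀ a, U.essImage (F.obj a)) (hG : ∀ b, T.essImage (G.obj b)) :
    ∃ e : Aᵒᵖ ≌ B, Nonempty (e.functor ⋙ U ≅ F) ∧ Nonempty (e.inverse.leftOp ⋙ T ≅ G) := by
  let F' : Aᵒᵖ ⥤ B := U.essImage.lift F hF ⋙ U.toEssImage.inv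
  let G' : Bᵒᵖ ⥤ A := T.essImage.lift G hG ⋙ T.toEssImage.inv
  let eF : F' ⋙ U ≅ F :=
    Functor.isoWhiskerLeft (U.essImage.lift F hF)
      (Functor.isoWhiskerRight U.toEssImage.asEquivalence.counitIso U.essImage.ι)
  let eG : G' ⋙ T ≅ G :=
    Functor.isoWhiskerLeft (T.essImage.lift G hG)
      (Functor.isoWhiskerRight T.toEssImage.asEquivalence.counitIso T.essImage.ι)
  let η : 𝟭 A ≅ F'.rightOp ⋙ G' := t.unitIso eF eG
  let ε : 𝟭 B ≅ G'.rightOp ⋙ F' := s.unitIso eG eF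
  refine ⟨CategoryTheory.Equivalence.mk F' G'.rightOp (NatIso.op η).symm ε.symm, ⟨eF⟩, ⟨eG⟩⟩

end antiequivalence

/-! ### The resolutions used in the derived functor -/

section minusResolution
variable {C : Type u} [Category.{v} C] [Abelian C] [HasDerivedCategory.{w} C]

open DerivedCategory

lemma isIso_Qh_map_quotient_map_iff {K L : CochainComplex C ℤ} (f : K ⟶ L) :
    IsIso (Qh.map ((HomotopyCategory.quotient C (.up ℤ)).map f)) ↔ QuasiIso f := by
  rw [DerivedCategory.isIso_Qh_map_iff, HomotopyCategory.quotient_map_mem_quasiIso_iff,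
    HomologicalComplex.mem_quasiIso_iff]

variable [EnoughProjectives C]

/-- The bounded above projective resolution of an object of the bounded above derived category. -/
noncomputable def minusResolution (X : DerivedCategory.Minus C) : HomotopyCategory C (.up ℤ) :=
  ((projMinusToMinus C).inv.obj X).obj

/-- A morphism lifts to the resolutions. -/
noncomputable def minusResolutionMap {X Y : DerivedCategory.Minus C} (f : X ⟶ Y) :
    minusResolution X ⟶ minusResolution Y :=
  ((projMinusToMinus C).inv.map f).hom

/-- The isomorphism in the derived category from a resolution to the object. -/
noncomputable def minusResolutionIso (X : DerivedCategory.Minus C) :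
    Qh.obj (minusResolution X) ≅ Minus.ι.obj X :=
  Minus.ι.mapIso ((projMinusToMinus C).asEquivalence.counitIso.app X)

lemma minusResolutionIso_hom_naturality {X Y : DerivedCategory.Minus C} (f : X ⟶ Y) :
    Qh.map (minusResolutionMap f) ≫ (minusResolutionIso Y).hom =
      (minusResolutionIso X).hom ≫ Minus.ι.map f :=
  congrArg Minus.ι.map ((projMinusToMinus C).asEquivalence.counitIso.hom.naturality f)

lemma Qh_map_bijective_of_minusResolution (X : DerivedCategory.Minus C)
    (K : HomotopyCategory C (.up ℤ)) :
    Function.Bijective (Qh.map : (minusResolution X ⟶ K) → _) := by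
  obtain ⟨⟨n, hn⟩, hP⟩ := ((projMinusToMinus C).inv.obj X).property
  have := CochainComplex.isKProjective_of_projective ((projMinusToMinus C).inv.obj X).obj.as n
  exact CochainComplex.IsKProjective.Qh_map_bijective ((projMinusToMinus C).inv.obj X).obj.as K

instance (X : DerivedCategory.Minus C) :
    CochainComplex.IsKProjective (minusResolution X).as := by
  obtain ⟨⟨n, hn⟩, hP⟩ := ((projMinusToMinus C).inv.obj X).property
  exact CochainComplex.isKProjective_of_projective ((projMinusToMinus C).inv.obj X).obj.as n

/-- This replaces the chosen resolution, whose terms are not controlled, by a complex of finitely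
generated projectives; K-projective complexes isomorphic in the derived category are homotopy
equivalent. -/
lemma nonempty_iso_minusResolution {M : CochainComplex C ℤ} [M.IsKProjective]
    {X : DerivedCategory.Minus C} (e : Q.obj M ≅ Minus.ι.obj X) :
    Nonempty ((HomotopyCategory.quotient C (.up ℤ)).obj M ≅ minusResolution X) := by
  let e' : Qh.obj ((HomotopyCategory.quotient C (.up ℤ)).obj M) ≅ Qh.obj (minusResolution X) :=
    (quotientCompQhIso C).app M ≪≫ e ≪≫ (minusResolutionIso X).symm
  obtain ⟨f, hf⟩ := (CochainComplex.IsKProjective.Qh_map_bijective M _).2 e'.hom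
  obtain ⟨g, hg⟩ := (Qh_map_bijective_of_minusResolution X _).2 e'.inv
  refine ⟨⟨f, g, (CochainComplex.IsKProjective.Qh_map_bijective M _).1 ?_,
    (Qh_map_bijective_of_minusResolution X _).1 ?_⟩⟩
  · rw [Functor.map_comp, hf, hg, e'.hom_inv_id, CategoryTheory.Functor.map_id]
  · rw [Functor.map_comp, hf, hg, e'.inv_hom_id, CategoryTheory.Functor.map_id]

end minusResolution

/-! ### Transposition for the derived functors and the theorem -/

section rHomTranspose
variable {R S T : Type u} [Ring R] [Ring S] [Ring T] {φ : R →+* T} {ψ : S →+* T}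
  (h : ∀ a r, Commute (φ a) (ψ r)) (h' : ∀ r a, Commute (ψ r) (φ a))
  {D : CochainComplex (ModuleCat.{u} T) ℤ}
  [HasDerivedCategory.{w} (ModuleCat.{u} R)] [HasDerivedCategory.{w} (ModuleCat.{u} S)]

open DerivedCategory

variable {X X' : DerivedCategory.Minus (ModuleCat.{u} R)}
  {Y Y' : DerivedCategory.Minus (ModuleCat.{u} S)}

/-- The value of the functor `RHom(-, D)` in terms of resolutions. -/
noncomputable abbrev minusHom {R : Type v} [Ring R] {C : Type u} [Category.{v} C] [Abelian C]
    [HasDerivedCategory.{w} C] [EnoughProjectives C] [HasDerivedCategory.{w} (ModuleCat.{v} R)]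
    {D : CochainComplex C ℤ} (ρ : R →+* End D) (X : DerivedCategory.Minus C) :
    DerivedCategory (ModuleCat.{v} R) :=
  Qh.obj ((homHotFunctor ρ).obj (op (minusResolution X)))

/-- The action of the functor `RHom(-, D)` on morphisms in terms of resolutions. -/
noncomputable abbrev minusHomMap {R : Type v} [Ring R] {C : Type u} [Category.{v} C] [Abelian C]
    [HasDerivedCategory.{w} C] [EnoughProjectives C] [HasDerivedCategory.{w} (ModuleCat.{v} R)]
    {D : CochainComplex C ℤ} (ρ : R →+* End D) {X X' : DerivedCategory.Minus C} (u : X' ⟶ X) :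
    minusHom ρ X ⟶ minusHom ρ X' :=
  Qh.map ((homHotFunctor ρ).map (minusResolutionMap u).op)

lemma exists_Qh_map_eq (f : Minus.ι.obj Y ⟶ minusHom (actionHom φ ψ h D) X) :
    ∃ g : minusResolution Y ⟶ (homHotFunctor (actionHom φ ψ h D)).obj (op (minusResolution X)),
      Qh.map g = (minusResolutionIso Y).hom ≫ f :=
  (Qh_map_bijective_of_minusResolution Y _).2 _

/-- The transposition of morphisms into the derived functor `RHom(-, D)`. -/
noncomputable def rHomTranspose (f : Minus.ι.obj Y ⟶ minusHom (actionHom φ ψ h D) X) :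
    Minus.ι.obj X ⟶ minusHom (actionHom ψ φ h' D) Y :=
  (minusResolutionIso X).inv ≫ Qh.map (hotTranspose h h' (exists_Qh_map_eq h f).choose)

/-- The lift to the homotopy category is unique because the resolution of Y is K-projective. -/
lemma rHomTranspose_eq {f : Minus.ι.obj Y ⟶ minusHom (actionHom φ ψ h D) X}
    {g : minusResolution Y ⟶ (homHotFunctor (actionHom φ ψ h D)).obj (op (minusResolution X))}
    (hg : Qh.map g = (minusResolutionIso Y).hom ≫ f) :
    rHomTranspose h h' f = (minusResolutionIso X).inv ≫ Qh.map (hotTranspose h h' g) := by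
  have := (Qh_map_bijective_of_minusResolution Y _).1
    (hg.trans (exists_Qh_map_eq h f).choose_spec.symm)
  rw [this]
  rfl

lemma rHomTranspose_comp_left (u : Y' ⟶ Y)
    (f : Minus.ι.obj Y ⟶ minusHom (actionHom φ ψ h D) X) :
    rHomTranspose h h' (Minus.ι.map u ≫ f) =
      rHomTranspose h h' f ≫ minusHomMap (actionHom ψ φ h' D) u := by
  obtain ⟨g, hg⟩ := exists_Qh_map_eq h f
  rw [rHomTranspose_eq h h' hg, rHomTranspose_eq h h' (g := minusResolutionMap u ≫ g) (by
    rw [Functor.map_comp, hg, ← Category.assoc, minusResolutionIso_hom_naturality,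
      Category.assoc]), hotTranspose_comp_left, Functor.map_comp, Category.assoc]

lemma rHomTranspose_comp_right (u : X' ⟶ X)
    (f : Minus.ι.obj Y ⟶ minusHom (actionHom φ ψ h D) X) :
    rHomTranspose h h' (f ≫ minusHomMap (actionHom φ ψ h D) u) =
      Minus.ι.map u ≫ rHomTranspose h h' f := by
  obtain ⟨g, hg⟩ := exists_Qh_map_eq h f
  rw [rHomTranspose_eq h h' hg, rHomTranspose_eq h h'
    (g := g ≫ (homHotFunctor (actionHom φ ψ h D)).map (minusResolutionMap u).op) (by
    rw [Functor.map_comp, hg, Category.assoc]), hotTranspose_comp_right, Functor.map_comp,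
    ← Category.assoc, ← Category.assoc]
  congr 1
  rw [Iso.inv_comp_eq, ← Category.assoc, ← minusResolutionIso_hom_naturality, Category.assoc,
    Iso.hom_inv_id, Category.comp_id]

/-- Represent g by a chain map; the claim becomes `quasiIso_homTranspose_iff` together with
biduality for M. -/
lemma isIso_Qh_map_hotTranspose {M : CochainComplex (ModuleCat.{u} R) ℤ} (hM : IsFinProj M) (d : ℤ)
    [M.IsStrictlyLE d] (hD₁ : HasFiniteInjectiveModel (resComplex φ D))
    (hD₂ : HasFiniteInjectiveModel (resComplex ψ D))
    (hD : IsHomothetyIso (actionHom ψ φ h' D)) {N : CochainComplex (ModuleCat.{u} S) ℤ}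
    [N.IsKProjective]
    (g : (HomotopyCategory.quotient _ (.up ℤ)).obj N ⟶
      (homHotFunctor (actionHom φ ψ h D)).obj (op ((HomotopyCategory.quotient _ (.up ℤ)).obj M)))
    (hg : IsIso (Qh.map g)) : IsIso (Qh.map (hotTranspose h h' g)) := by
  obtain ⟨g, rfl⟩ := (HomotopyCategory.quotient _ (.up ℤ)).map_surjective (X := N)
    (Y := homComplex (actionHom φ ψ h D) M) g
  obtain ⟨J, j, _, _, _⟩ := hD₂.exists_quasiIso
  have := (isIso_Qh_map_quotient_map_iff g).1 hg
  refine (congrArg (fun k ↦ IsIso (Qh.map k)) (hotTranspose_quotient_map h h' g)).mpr ?_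
  exact (isIso_Qh_map_quotient_map_iff _).2 ((quasiIso_homTranspose_iff h h' j g).2
    (hM.quasiIso_biduality h d j hD₁ hD₂ hD))

lemma isIso_rHomTranspose {M : CochainComplex (ModuleCat.{u} R) ℤ} (hM : IsFinProj M) (d : ℤ)
    [M.IsStrictlyLE d] (e : Q.obj M ≅ Minus.ι.obj X)
    (hD₁ : HasFiniteInjectiveModel (resComplex φ D))
    (hD₂ : HasFiniteInjectiveModel (resComplex ψ D))
    (hD : IsHomothetyIso (actionHom ψ φ h' D))
    (f : Minus.ι.obj Y ⟶ minusHom (actionHom φ ψ h D) X) (hf : IsIso f) :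
    IsIso (rHomTranspose h h' f) := by
  have := hM.isKProjective d
  obtain ⟨g, hg⟩ := exists_Qh_map_eq h f
  obtain ⟨a⟩ := nonempty_iso_minusResolution e
  have : IsIso (Qh.map g) := by
    rw [hg]
    infer_instance
  have : IsIso (Qh.map (g ≫ (homHotFunctor (actionHom φ ψ h D)).map a.hom.op)) := by
    rw [Functor.map_comp]
    infer_instance
  have : IsIso (Qh.map (hotTranspose h h'
      (g ≫ (homHotFunctor (actionHom φ ψ h D)).map a.hom.op))) :=
    isIso_Qh_map_hotTranspose h h' hM d hD₁ hD₂ hD (N := (minusResolution Y).as) _ this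
  rw [hotTranspose_comp_right, Functor.map_comp] at this
  have := IsIso.of_isIso_comp_left (Qh.map a.hom) (Qh.map (hotTranspose h h' g))
  rw [rHomTranspose_eq h h' hg]
  infer_instance

/-- The lower bound a' - d comes from the bounds on M above and D below, the upper bound b' - c from
the injective dimension of D over R. Finite presentation over S comes from the other structure on D.
-/
lemma essImage_minusHom [IsLeftCoherent S] [HasDerivedCategory.{w} (FpModuleCat S)]
    {M : CochainComplex (ModuleCat.{u} R) ℤ} (hM : IsFinProj M) (c d : ℤ)
    [M.IsGE c] [M.IsStrictlyLE d] (e : Q.obj M ≅ Minus.ι.obj X)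
    (hD : HasFiniteInjectiveModel (resComplex φ D)) (hD' : HasFpHomology (resComplex ψ D)) :
    (fpToDerived S).essImage (minusHom (actionHom φ ψ h D) X) := by
  have := hM.isKProjective d
  obtain ⟨a⟩ := nonempty_iso_minusResolution e
  obtain ⟨a', ha'⟩ := hD.exists_isGE
  obtain ⟨b', hb'⟩ := hD.exists_hasInjectiveDimensionLE
  have := homComplex_isGE (actionHom φ ψ h D) (M := M)
    (fun _ ↦ CochainComplex.IsKProjective.Qh_map_bijective _ _) (d := d) le_rfl ha'
  have := homComplex_isLE (actionHom φ ψ h D) (M := M)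
    (fun _ ↦ CochainComplex.IsKProjective.Qh_map_bijective _ _) (c := c) le_rfl hb'
  refine (fpToDerived S).essImage.prop_of_iso ?_ (essImage_Q_obj _ (a' - d) (b' - c)
    (hM.hasFpHomology_homComplex h d hD hD'))
  exact (quotientCompQhIso _).symm.app (homComplex (actionHom φ ψ h D) M) ≪≫
    Qh.mapIso ((homHotFunctor (actionHom φ ψ h D)).mapIso a.symm.op)

variable [IsLeftCoherent R] [HasDerivedCategory.{w} (FpModuleCat R)]
  [IsLeftCoherent S] [HasDerivedCategory.{w} (FpModuleCat S)]

/-- The transposition of morphisms into the derived functor `RHom(-, D)`. -/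
noncomputable def rHomTransposition
    (hD₁ : HasFiniteInjectiveModel (resComplex φ D))
    (hD₂ : HasFiniteInjectiveModel (resComplex ψ D))
    (hD : IsHomothetyIso (actionHom ψ φ h' D)) :
    Transposition (fpToMinus R ⋙ Minus.ι) (fpToMinus S ⋙ Minus.ι)
      ((fpToMinus R).op ⋙ rHom _ (actionHom φ ψ h D))
      ((fpToMinus S).op ⋙ rHom _ (actionHom ψ φ h' D)) where
  map {a b} f := rHomTranspose h h' (X := (fpToMinus R).obj a) (Y := (fpToMinus S).obj b) f
  map_comp_left u f := rHomTranspose_comp_left h h' ((fpToMinus S).map u) f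
  map_comp_right u f := rHomTranspose_comp_right h h' ((fpToMinus R).map u) f
  isIso {a b} f hf := by
    obtain ⟨P, _, d, _, _, hP, ⟨e⟩⟩ := FpModuleCat.exists_isFinProj a
    exact isIso_rHomTranspose h h' (X := (fpToMinus R).obj a) (Y := (fpToMinus S).obj b)
      hP d e hD₁ hD₂ hD f hf

lemma exists_equivalence_rHom (hD₁ : HasFiniteInjectiveModel (resComplex φ D))
    (hD₂ : HasFiniteInjectiveModel (resComplex ψ D))
    (hD₁' : HasFpHomology (resComplex φ D)) (hD₂' : HasFpHomology (resComplex ψ D))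
    (hD : IsHomothetyIso (actionHom ψ φ h' D)) (hD' : IsHomothetyIso (actionHom φ ψ h D)) :
    ∃ e : (DerivedCategory.Bounded (FpModuleCat R))ᵒᵖ ≌ DerivedCategory.Bounded (FpModuleCat S),
      Nonempty (e.functor ⋙ fpToMinus S ⋙ Minus.ι ≅
        (fpToMinus R).op ⋙ rHom _ (actionHom φ ψ h D)) ∧
      Nonempty (e.inverse.leftOp ⋙ fpToMinus R ⋙ Minus.ι ≅
        (fpToMinus S).op ⋙ rHom _ (actionHom ψ φ h' D)) := by
  refine exists_equivalence_of_transposition (rHomTransposition h h' hD₁ hD₂ hD)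
    (rHomTransposition h' h hD₂ hD₁ hD') (fun a ↦ ?_) fun b ↦ ?_
  · obtain ⟨P, c, d, _, _, hP, ⟨e⟩⟩ := FpModuleCat.exists_isFinProj a.unop
    exact essImage_minusHom h (X := (fpToMinus R).obj a.unop) hP c d e hD₁ hD₂'
  · obtain ⟨P, c, d, _, _, hP, ⟨e⟩⟩ := FpModuleCat.exists_isFinProj b.unop
    exact essImage_minusHom h' (X := (fpToMinus S).obj b.unop) hP c d e hD₂ hD₁'

end rHomTranspose

/-- Biduality for left A-modules uses the homothety of A on D as a complex of right B-modules, and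
conversely. -/
theorem mainTheorem9 {A B : Type u} [Ring A] [Ring B] [IsLeftCoherent A] [IsRightCoherent B]
    [HasDerivedCategory.{w} (ModuleCat.{u} A)] [HasDerivedCategory.{w} (ModuleCat.{u} Bᵐᵒᵖ)]
    [HasDerivedCategory.{w} (FpModuleCat A)] [HasDerivedCategory.{w} (FpModuleCat Bᵐᵒᵖ)]
    (D : CochainComplex (BimodCat A B) ℤ) (hD : IsWeakDualizingComplex D) :
    ∃ e : (DerivedCategory.Bounded (FpModuleCat A))ᵒᵖ ≌
        DerivedCategory.Bounded (FpModuleCat Bᵐᵒᵖ),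
      Nonempty (e.functor ⋙ fpToMinus Bᵐᵒᵖ ⋙ DerivedCategory.Minus.ι ≅
        (fpToMinus A).op ⋙ rHomLeft D) ∧
      Nonempty (e.inverse.leftOp ⋙ fpToMinus A ⋙ DerivedCategory.Minus.ι ≅
        (fpToMinus Bᵐᵒᵖ).op ⋙ rHomRight D) :=
  exists_equivalence_rHom (φ := bimodLeft A B) (ψ := bimodRight A B)
    commute_bimodLeft_bimodRight (fun b a ↦ (commute_bimodLeft_bimodRight a b).symm)
    hD.left_injective hD.right_injective
    (hasFpHomology_resComplex _ hD.left_finitePresentation)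
    (hasFpHomology_resComplex _ hD.right_finitePresentation) hD.left_homothety hD.right_homothety
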